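/- Let $r\ge 1$, let $\zeta\in\mathbb C$ be a primitive $r$-th root of unity, and for $n\ge 0$ let $H_n=H_n(\zeta)$ be the Hecke algebra over $\mathbb C$ with generators $T_1,\dots,T_{n-1}$ and relations $T_i^2=(\zeta-1)T_i+\zeta$, $T_iT_j=T_jT_i$ for $|i-j|>1$, and $T_iT_{i+1}T_i=T_{i+1}T_iT_{i+1}$. Let $\rho_{m,n}\colon H_m\otimes H_n\to H_{m+n}$ be the algebra homomorphism $T_i\otimes 1\mapsto T_i$, $1\otimes T_j\mapsto T_{m+j}$. For a left $H_m$-module $M$ and a left $H_n$-module $N$ let $M\cdot N=\mathrm{Ind}_{H_m\otimes H_n}^{H_{m+n}}(M\otimes N)$ be the module induced along $\rho_{m,n}$. For left $H_n$-modules $P,M$ put $\langle P,M\rangle=\dim_{\mathbb C}\mathrm{Hom}_{H_n}(P,M)$. For every $n$ there are a finite complete list $(S^{(n)}_i)_i$ of pairwise nonisomorphic simple left $H_n$-modules and a complete list $(P^{(n)}_i)_i$ of pairwise nonisomorphic indecomposable finitely generated projective left $H_n$-modules such that $P^{(n)}_i$ is a projective cover of $S^{(n)}_i$. Fix any such lists.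 Let $V$ be the set of all pairs $(n,i)$, with height $h(n,i)=n$. Define graphs $\Gamma$ (the branching graph of the simple modules) and $\Gamma'$ (the branching graph of the indecomposable projective modules) on $V$ by the edge multiplicities $$m_\Gamma\big((n,i),(n+1,j)\big)=\sum_l \dim(P^{(1)}_l)\,\big\langle P^{(n+1)}_j,\ S^{(1)}_l\cdot S^{(n)}_i\big\rangle,$$ $$m_{\Gamma'}\big((n,i),(n+1,j)\big)=\sum_l \dim(S^{(1)}_l)\,\big\langle P^{(1)}_l\cdot P^{(n)}_i,\ S^{(n+1)}_j\big\rangle,$$ all other multiplicities being $0$ (since $H_1=\mathbb C$, each sum has a single term, with dimension factor $1$). Then $(\Gamma,\Gamma')$ is a pair of dual graded graphs with differential coefficient $1$. That is, $\Gamma$ and $\Gamma'$ are locally finite graded graphs (each edge raises the height by one, each vertex has finitely many outgoing and incoming edges) with a single vertex of height $0$, and the linear operators on $\mathbb ZV$ given by $U_\Gamma(v)=\sum_u m_\Gamma(v,u)\,u$ and $D_{\Gamma'}(v)=\sum_u m_{\Gamma'}(u,v)\,u$ satisfy $$D_{\Gamma'}U_\Gamma-U_\Gamma D_{\Gamma'}=\mathrm{Id}.$$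 -/

import Mathlib

open scoped TensorProduct

noncomputable section

/-! ### Graded graphs and dual pairs -/

/-- A vertex set with a height function and an edge multiplicity function. The pair `(v, u)` is an
edge exactly when `mult v u ≠ 0`. -/
structure WeightedGraph (V : Type*) where
  height : V → ℕ
  mult : V → V → ℕ

namespace WeightedGraph

variable {V : Type*}

/-- The axioms of a (locally finite) graded graph: edges raise the height by one, there is a single
vertex of height `0`, and every vertex lies on finitely many outgoing and incoming edges. -/
structure IsGraded (Γ : WeightedGraph V) : Prop where
  height_eq : ∀ v u, Γ.mult v u ≠ 0 → Γ.height u = Γ.height v + 1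
  existsUnique_root : ∃! v, Γ.height v = 0
  finite_out : ∀ v, {u | Γ.mult v u ≠ 0}.Finite
  finite_in : ∀ v, {u | Γ.mult u v ≠ 0}.Finite

/-- The up operator `U v = ∑ u, m(v, u) u` on the free abelian group `ℤV`; for a locally finite
graph the sum has finitely many nonzero terms. -/
def up (Γ : WeightedGraph V) : (V →₀ ℤ) →ₗ[ℤ] (V →₀ ℤ) :=
  Finsupp.linearCombination ℤ fun v => ∑ᶠ u, Finsupp.single u (Γ.mult v u : ℤ)

/-- The down operator `D v = ∑ u, m(u, v) u` on the free abelian group `ℤV`. -/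
def down (Γ : WeightedGraph V) : (V →₀ ℤ) →ₗ[ℤ] (V →₀ ℤ) :=
  Finsupp.linearCombination ℤ fun v => ∑ᶠ u, Finsupp.single u (Γ.mult u v : ℤ)

/-- `(Γ, Γ')` is a pair of dual graded graphs with differential coefficient `r`: both are graded
graphs, on the same vertex set and with the same height function, and
`D_{Γ'} U_Γ - U_Γ D_{Γ'} = r Id`. -/
structure IsDualPair (Γ Γ' : WeightedGraph V) (r : ℤ) : Prop where
  graded_left : Γ.IsGraded
  graded_right : Γ'.IsGraded
  height_eq : Γ.height = Γ'.height
  commutator : Γ'.down ∘ₗ Γ.up - Γ.up ∘ₗ Γ'.down = r • LinearMap.id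

end WeightedGraph

/-! ### The tower of Hecke algebras -/

/-- The defining relations of `H_n(v)`. The generators `T_1, …, T_{n-1}` are indexed from `0`, by
`Fin (n - 1)` (so that there are none for `n = 0` and `n = 1`). -/
inductive HeckeRel (n : ℕ) (v : ℂ) :
    FreeAlgebra ℂ (Fin (n - 1)) → FreeAlgebra ℂ (Fin (n - 1)) → Prop
  | quad (i : Fin (n - 1)) :
      HeckeRel n v (FreeAlgebra.ι ℂ i * FreeAlgebra.ι ℂ i)
        ((v - 1) • FreeAlgebra.ι ℂ i + algebraMap ℂ _ v)
  | comm (i j : Fin (n - 1)) (hij : (i : ℕ) + 1 < j ∨ (j : ℕ) + 1 < i) :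
      HeckeRel n v (FreeAlgebra.ι ℂ i * FreeAlgebra.ι ℂ j)
        (FreeAlgebra.ι ℂ j * FreeAlgebra.ι ℂ i)
  | braid (i j : Fin (n - 1)) (hij : (j : ℕ) = i + 1) :
      HeckeRel n v (FreeAlgebra.ι ℂ i * FreeAlgebra.ι ℂ j * FreeAlgebra.ι ℂ i)
        (FreeAlgebra.ι ℂ j * FreeAlgebra.ι ℂ i * FreeAlgebra.ι ℂ j)

/-- The Hecke algebra `H_n(v)` over `ℂ`. -/
def Hecke (n : ℕ) (v : ℂ) : Type := RingQuot (HeckeRel n v)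

namespace Hecke

variable {m n N : ℕ} {v : ℂ}

instance instRing (n : ℕ) (v : ℂ) : Ring (Hecke n v) :=
  inferInstanceAs (Ring (RingQuot (HeckeRel n v)))

instance instAlgebra (n : ℕ) (v : ℂ) : Algebra ℂ (Hecke n v) :=
  inferInstanceAs (Algebra ℂ (RingQuot (HeckeRel n v)))

/-- The quotient map from the free algebra. -/
def mk (n : ℕ) (v : ℂ) : FreeAlgebra ℂ (Fin (n - 1)) →ₐ[ℂ] Hecke n v :=
  RingQuot.mkAlgHom ℂ (HeckeRel n v)

/-- The generators of `H_n(v)`. -/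
def T (v : ℂ) (i : Fin (n - 1)) : Hecke n v :=
  mk n v (FreeAlgebra.ι ℂ i)

theorem mk_rel {a b : FreeAlgebra ℂ (Fin (n - 1))} (h : HeckeRel n v a b) :
    mk n v a = mk n v b :=
  RingQuot.mkAlgHom_rel ℂ h

theorem mk_surjective : Function.Surjective (mk n v) :=
  RingQuot.mkAlgHom_surjective ℂ (HeckeRel n v)

/-- The universal property of `H_n(v)`. -/
def lift {A : Type*} [Ring A] [Algebra ℂ A] (f : FreeAlgebra ℂ (Fin (n - 1)) →ₐ[ℂ] A)
    (hf : ∀ ⦃a b⦄, HeckeRel n v a b → f a = f b) : Hecke n v →ₐ[ℂ] A :=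
  RingQuot.liftAlgHom ℂ ⟨f, hf⟩

theorem lift_mk {A : Type*} [Ring A] [Algebra ℂ A] (f : FreeAlgebra ℂ (Fin (n - 1)) →ₐ[ℂ] A)
    (hf : ∀ ⦃a b⦄, HeckeRel n v a b → f a = f b) (x : FreeAlgebra ℂ (Fin (n - 1))) :
    lift f hf (mk n v x) = f x :=
  RingQuot.liftAlgHom_mkAlgHom_apply ℂ f hf x

theorem T_quad (i : Fin (n - 1)) :
    (T v i * T v i : Hecke n v) = (v - 1) • T v i + algebraMap ℂ _ v := by
  simpa [T] using mk_rel (HeckeRel.quad (v := v) i)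

theorem T_comm (i j : Fin (n - 1)) (hij : (i : ℕ) + 1 < j ∨ (j : ℕ) + 1 < i) :
    (T v i * T v j : Hecke n v) = T v j * T v i := by
  simpa [T] using mk_rel (HeckeRel.comm (v := v) i j hij)

theorem T_braid (i j : Fin (n - 1)) (hij : (j : ℕ) = i + 1) :
    (T v i * T v j * T v i : Hecke n v) = T v j * T v i * T v j := by
  simpa [T] using mk_rel (HeckeRel.braid (v := v) i j hij)

/-- The homomorphism `H_n(v) → H_N(v)` with `T_i ↦ T_{k+i}`, for `k + n ≤ N`. -/
def shift (v : ℂ) (k : ℕ) (h : k + n ≤ N) : Hecke n v →ₐ[ℂ] Hecke N v :=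
  lift
    (FreeAlgebra.lift ℂ fun i : Fin (n - 1) =>
      (T v (⟨k + i, by have := i.isLt; omega⟩ : Fin (N - 1)) : Hecke N v)) <| by
      rintro _ _ (i | ⟨i, j, hij⟩ | ⟨i, j, hij⟩)
      · simpa using T_quad _
      · simpa using T_comm _ _ (by simp only; omega)
      · simpa using T_braid _ _ (by simp only; omega)

@[simp]
theorem shift_T (k : ℕ) (h : k + n ≤ N) (i : Fin (n - 1)) :
    shift v k h (T v i) = T v ⟨k + i, by have := i.isLt; omega⟩ := by
  simp [shift, T, lift_mk]

/-- An element commuting with the images of all generators commutes with the image of `shift`. -/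
theorem shift_commute (k : ℕ) (h : k + n ≤ N) (z : Hecke N v)
    (hz : ∀ i : Fin (n - 1), Commute (shift v k h (T v i)) z) (x : Hecke n v) :
    Commute (shift v k h x) z := by
  obtain ⟨y, rfl⟩ := mk_surjective x
  induction y using FreeAlgebra.induction with
  | grade0 c =>
    simp only [AlgHom.commutes]
    exact Algebra.commutes c z
  | grade1 i => exact hz i
  | mul a b ha hb => simpa only [map_mul] using ha.mul_left hb
  | add a b ha hb => simpa only [map_add] using ha.add_left hb

/-- The external multiplication `ρ : H_m(v) ⊗ H_n(v) → H_{m+n}(v)`, `T_i ⊗ 1 ↦ T_i` and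
`1 ⊗ T_j ↦ T_{m+j}`. The target is written `H_N(v)` with `m + n = N`. -/
def extMul (v : ℂ) (h : m + n = N) : Hecke m v ⊗[ℂ] Hecke n v →ₐ[ℂ] Hecke N v :=
  Algebra.TensorProduct.lift (shift v 0 (by omega)) (shift v m (by omega)) fun x y => by
    refine shift_commute 0 _ _ (fun i => ?_) x
    refine (shift_commute m _ _ (fun j => ?_) y).symm
    rw [shift_T, shift_T]
    exact T_comm _ _ (by right; have := i.isLt; simp only; omega)

end Hecke

/-! ### Simple modules, projective covers, induction and the pairing -/

section Modules

/-- A nonzero module that is not a direct sum of two nonzero submodules. -/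
def IsIndecomposableModule (R M : Type*) [Ring R] [AddCommGroup M] [Module R M] : Prop :=
  Nontrivial M ∧ ∀ A B : Submodule R M, IsCompl A B → A = ⊥ ∨ B = ⊥

/-- `π : P → S` is a projective cover: `P` is projective and `π` is a surjection whose kernel is
superfluous. -/
def IsProjectiveCover {R P S : Type*} [Ring R] [AddCommGroup P] [Module R P] [AddCommGroup S]
    [Module R S] (π : P →ₗ[R] S) : Prop :=
  Module.Projective R P ∧ Function.Surjective π ∧
    ∀ N : Submodule R P, N ⊔ LinearMap.ker π = ⊤ → N = ⊤

/-- A complete list `S_1, …, S_s` of pairwise nonisomorphic simple left `R`-modules, and a complete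
list `P_1, …, P_s` of pairwise nonisomorphic indecomposable finitely generated projective left
`R`-modules, numbered so that `P_i` is a projective cover of `S_i`. -/
structure SimpleProjectiveList (R : Type) [Ring R] where
  card : ℕ
  S : Fin card → ModuleCat.{0} R
  P : Fin card → ModuleCat.{0} R
  simple : ∀ i, IsSimpleModule R (S i)
  simple_inj : ∀ i j, Nonempty (S i ≃ₗ[R] S j) → i = j
  simple_complete : ∀ (M : Type) [AddCommGroup M] [Module R M], IsSimpleModule R M →
    ∃ i, Nonempty (M ≃ₗ[R] S i)
  finite : ∀ i, Module.Finite R (P i)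
  projective : ∀ i, Module.Projective R (P i)
  indecomposable : ∀ i, IsIndecomposableModule R (P i)
  projective_inj : ∀ i j, Nonempty (P i ≃ₗ[R] P j) → i = j
  projective_complete : ∀ (M : Type) [AddCommGroup M] [Module R M], Module.Finite R M →
    Module.Projective R M → IsIndecomposableModule R M → ∃ i, Nonempty (M ≃ₗ[R] P i)
  cover : ∀ i, ∃ π : P i →ₗ[R] S i, IsProjectiveCover π

end Modules

namespace Hecke

variable {m n N : ℕ} {v : ℂ}

/-- The complex vector space underlying a left `H_n(v)`-module. -/
instance moduleComplex (M : ModuleCat.{0} (Hecke n v)) : Module ℂ M :=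
  Module.compHom M (algebraMap ℂ (Hecke n v))

instance isScalarTowerComplex (M : ModuleCat.{0} (Hecke n v)) :
    IsScalarTower ℂ (Hecke n v) M :=
  ⟨fun c a x => by
    rw [Algebra.smul_def, mul_smul]
    rfl⟩

/-- The relations `a ρ(b ⊗ c) ⊗ (x ⊗ y) ≡ a ⊗ (b x ⊗ c y)` in `H_{m+n}(v) ⊗ (X ⊗ Y)`. -/
def indRel (h : m + n = N) (X : ModuleCat.{0} (Hecke m v)) (Y : ModuleCat.{0} (Hecke n v)) :
    Submodule (Hecke N v) (Hecke N v ⊗[ℂ] (X ⊗[ℂ] Y)) :=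
  Submodule.span (Hecke N v)
    {t | ∃ (a : Hecke N v) (b : Hecke m v) (c : Hecke n v) (x : X) (y : Y),
      t = (a * extMul v h (b ⊗ₜ[ℂ] c)) ⊗ₜ[ℂ] (x ⊗ₜ[ℂ] y) - a ⊗ₜ[ℂ] ((b • x) ⊗ₜ[ℂ] (c • y))}

/-- The induced module `Ind (X ⊗ Y)` from `H_m(v) ⊗ H_n(v)` to `H_{m+n}(v)` along the external
multiplication, as a left `H_{m+n}(v)`-module. -/
def indProd (h : m + n = N) (X : ModuleCat.{0} (Hecke m v)) (Y : ModuleCat.{0} (Hecke n v)) :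
    ModuleCat.{0} (Hecke N v) :=
  ModuleCat.of (Hecke N v) ((Hecke N v ⊗[ℂ] (X ⊗[ℂ] Y)) ⧸ indRel h X Y)

/-- The pairing `⟨[P], [M]⟩ = dim Hom_{H_n(v)}(P, M)`. -/
def pairing (P M : ModuleCat.{0} (Hecke n v)) : ℕ :=
  Module.finrank ℂ (P →ₗ[Hecke n v] M)

/-- The vertices: pairs of `n` and an index of the list for `H_n(v)`; the vertex `⟨n, i⟩` stands
both for the simple module `S_i` and for its projective cover `P_i`. -/
abbrev Vertex (L : ∀ n, SimpleProjectiveList (Hecke n v)) : Type :=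
  Σ n, Fin (L n).card

/-- The branching graph `Γ` of the simple modules. The multiplicity `m(S_λ, S_μ)` is
`⟨[P_μ], β [S_λ]⟩`, with `β = ∑ i, dim (P_i) [S_i]` over the list for `H_1(v)`. -/
def simpleGraph (L : ∀ n, SimpleProjectiveList (Hecke n v)) : WeightedGraph (Vertex L) where
  height x := x.1
  mult x y :=
    if h : 1 + x.1 = y.1 then
      ∑ i : Fin (L 1).card,
        Module.finrank ℂ ((L 1).P i) *
          pairing ((L y.1).P y.2) (indProd h ((L 1).S i) ((L x.1).S x.2))
    else 0

/-- The branching graph `Γ'` of the indecomposable projective modules. The multiplicity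
`m'(P_λ, P_μ)` is `⟨α [P_λ], [S_μ]⟩`, with `α = ∑ i, dim (S_i) [P_i]` over the list for `H_1(v)`. -/
def projectiveGraph (L : ∀ n, SimpleProjectiveList (Hecke n v)) : WeightedGraph (Vertex L) where
  height x := x.1
  mult x y :=
    if h : 1 + x.1 = y.1 then
      ∑ i : Fin (L 1).card,
        Module.finrank ℂ ((L 1).S i) *
          pairing (indProd h ((L 1).P i) ((L x.1).P x.2)) ((L y.1).S y.2)
    else 0

end Hecke

end

/-! Since `H_1 = ℂ`, multiplying by its unique simple or projective module is induction Ind from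
`H_n` to `H_{n+1}` along `T_i ↦ T_{i+1}`. So `m_Γ` is the multiplicity of `S_j` in `Ind S_i`, and by
Frobenius reciprocity (`pairing_indProd`) `m_Γ'` is `dim Hom(P_i, Res S_j)`. The functions `dim
Hom(P, Res -)` and `dim Hom(P, Ind -)` are additive on short exact sequences and `dim Hom(P_i, S_j)
= δ_ij`, so summing over intermediate vertices composes the functors (`eq_sum_pairing`): from
`(n,i)` to `(n,l)`, `DU` has coefficient `dim Hom(P_l, Res Ind S_i)` and `UD` has `dim Hom(P_l, Ind
Res S_i)`. Everything then reduces to the Mackey decomposition `Res Ind M ≅ M ⊕ Ind Res M`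
(`pairing_res_indModel`): the first summand contributes `δ_il`, the identity.

Mackey rests on the basis `T_{k-1} ⋯ T_0`, `0 ≤ k ≤ n`, of `H_{n+1}` over `H_n`. Spanning is a
straightening argument (`exists_sum_cosetRep`). For independence, the expected action is written
down on `M^{n+1}` and the Hecke relations are verified (`indOp_quad`, `indOp_comm`, `indOp_braid`);
this model is isomorphic to the induced module (`nonempty_indProd_equiv`). In the model, splitting
off coordinate `0` is the Mackey decomposition.

Lists of simples and projective covers exist because `H_n` is finite-dimensional, hence Artinian;
covers come from Fitting's lemma (`exists_isProjectiveCover`). -/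

noncomputable section

/-! ### Simple modules and projective covers over Artinian rings -/

section Covers

variable {R : Type*} [Ring R]

/-- Finitely many simple modules, up to isomorphism, admit a nonzero homomorphism from a given
module of finite length. -/
theorem IsFiniteLength.exists_finite_ideals {M : Type*} [AddCommGroup M] [Module R M]
    (hM : IsFiniteLength R M) :
    ∃ F : Set (Ideal R), F.Finite ∧ ∀ (S : Type*) [AddCommGroup S] [Module R S],
      IsSimpleModule R S → ∀ f : M →ₗ[R] S, f ≠ 0 → ∃ I ∈ F, Nonempty (S ≃ₗ[R] R ⧸ I) := by
  induction hM with
  | of_subsingleton =>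
    exact ⟨∅, Set.finite_empty, fun S _ _ _ f hf => (hf (Subsingleton.elim _ _)).elim⟩
  | @of_simple_quotient M _ _ N hN _ ih =>
    obtain ⟨F, hF, h⟩ := ih
    obtain ⟨I, hI, ⟨e⟩⟩ := isSimpleModule_iff_quot_maximal.1 ‹IsSimpleModule R (M ⧸ N)›
    refine ⟨insert I F, hF.insert I, fun S _ _ hS f hf => ?_⟩
    -- A map vanishing on `N` factors through the simple quotient `M ⧸ N`, which accounts for the
    -- one new ideal; otherwise induction applies to the restriction.
    by_cases hfN : f ∘ₗ N.subtype = 0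
    · have hle : N ≤ LinearMap.ker f := fun x hx => by
        simpa using LinearMap.congr_fun hfN ⟨x, hx⟩
      have hne : N.liftQ f hle ≠ 0 := fun h0 => hf <| by
        rw [← N.liftQ_mkQ f hle, h0, LinearMap.zero_comp]
      exact ⟨I, Set.mem_insert _ _,
        ⟨(LinearEquiv.ofBijective _ (LinearMap.bijective_of_ne_zero hne)).symm.trans e⟩⟩
    · obtain ⟨J, hJ, hSJ⟩ := h S hS _ hfN
      exact ⟨J, Set.mem_insert_of_mem _ hJ, hSJ⟩

variable {P S : Type*} [AddCommGroup P] [Module R P] [AddCommGroup S] [Module R S]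

/-- A surjection whose kernel is superfluous identifies all simple quotients of its source. -/
theorem IsProjectiveCover.le_ker [IsSimpleModule R S] {π : P →ₗ[R] S} (h : IsProjectiveCover π)
    {N : Submodule R P} (hN : N ≠ ⊤) : N ≤ LinearMap.ker π := by
  have hco := LinearMap.isCoatom_ker_of_surjective h.2.1
  by_contra hle
  refine hN (h.2.2 N ?_)
  exact hco.2 _ (right_lt_sup.2 hle)

/-- The target of a projective cover of a simple module is the only simple quotient. -/
theorem IsProjectiveCover.nonempty_equiv [IsSimpleModule R S] {π : P →ₗ[R] S}
    (h : IsProjectiveCover π) {S' : Type*} [AddCommGroup S'] [Module R S'] [IsSimpleModule R S']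
    {f : P →ₗ[R] S'} (hf : f ≠ 0) : Nonempty (S ≃ₗ[R] S') := by
  have hf' := LinearMap.surjective_of_ne_zero hf
  have hco := LinearMap.isCoatom_ker_of_surjective hf'
  have hπ := LinearMap.isCoatom_ker_of_surjective h.2.1
  have hker : LinearMap.ker f = LinearMap.ker π :=
    (hco.le_iff_eq hπ.1).1 (h.le_ker hco.1) |>.symm
  exact ⟨(π.quotKerEquivOfSurjective h.2.1).symm.trans
    ((Submodule.quotEquivOfEq _ _ hker.symm).trans (f.quotKerEquivOfSurjective hf'))⟩

/-- `ker π` is the largest proper submodule, so two proper summands both lie in it and cannot span.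
-/
theorem IsProjectiveCover.isIndecomposableModule [IsSimpleModule R S] {π : P →ₗ[R] S}
    (h : IsProjectiveCover π) : IsIndecomposableModule R P := by
  have := IsSimpleModule.nontrivial R S
  refine ⟨h.2.1.nontrivial, fun A B hAB => ?_⟩
  by_contra! hne
  have hA : A ≠ ⊤ := fun hA => hne.2 (by simpa [hA] using hAB.inf_eq_bot)
  have hB : B ≠ ⊤ := fun hB => hne.1 (by simpa [hB] using hAB.inf_eq_bot)
  have hle := sup_le (h.le_ker hA) (h.le_ker hB)
  rw [hAB.sup_eq_top] at hle
  exact (LinearMap.isCoatom_ker_of_surjective h.2.1).1 (top_le_iff.1 hle)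

/-- An indecomposable projective module with a nonzero map to a simple module is isomorphic to
the projective cover of that module. -/
theorem IsProjectiveCover.nonempty_equiv_of_indecomposable [IsSimpleModule R S] {π : P →ₗ[R] S}
    (h : IsProjectiveCover π) {M : Type*} [AddCommGroup M] [Module R M] [Module.Projective R M]
    (hM : IsIndecomposableModule R M) {q : M →ₗ[R] S} (hq : q ≠ 0) :
    Nonempty (M ≃ₗ[R] P) := by
  have hP := h.1
  obtain ⟨f, hf⟩ := Module.projective_lifting_property π q h.2.1
  have hsurj : Function.Surjective f := by
    rw [← LinearMap.range_eq_top]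
    by_contra hne
    refine hq ?_
    rw [← hf]
    exact LinearMap.range_le_ker_iff.1 (h.le_ker hne)
  -- `P` is projective, so `f` splits; indecomposability of `M` then forces its kernel to vanish.
  obtain ⟨g, hg⟩ := Module.projective_lifting_property f LinearMap.id hsurj
  have hg' : ∀ x, f (g x) = x := LinearMap.congr_fun hg
  have hcompl : IsCompl (LinearMap.range g) (LinearMap.ker f) := by
    have hker : LinearMap.ker (g.rangeRestrict ∘ₗ f) = LinearMap.ker f := by
      refine LinearMap.ker_comp_of_ker_eq_bot _ ?_
      rw [LinearMap.ker_rangeRestrict]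
      exact LinearMap.ker_eq_bot_of_inverse hg
    rw [← hker]
    refine LinearMap.isCompl_of_proj ?_
    rintro ⟨_, y, rfl⟩
    ext
    simp [hg']
  rcases hM.2 _ _ hcompl with h0 | h0
  · have hg0 : ∀ y, g y = 0 := fun y => by
      have : g y ∈ LinearMap.range g := ⟨y, rfl⟩
      simpa [h0] using this
    have := h.isIndecomposableModule.1
    obtain ⟨y, hy⟩ := exists_ne (0 : P)
    exact (hy (by rw [← hg' y, hg0, map_zero])).elim
  · exact ⟨LinearEquiv.ofBijective f ⟨LinearMap.ker_eq_bot.1 h0, hsurj⟩⟩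

/-- The cover is a minimal element among the projective left ideals with a nonzero map to `R ⧸ I`;
`R` itself is one of them. -/
theorem exists_isProjectiveCover [IsArtinianRing R] (I : Ideal R) (hI : IsSimpleModule R (R ⧸ I)) :
    ∃ (P : Submodule R R) (π : P →ₗ[R] R ⧸ I), IsProjectiveCover π := by
  have hne : {P : Submodule R R | Module.Projective R P ∧ ∃ f : P →ₗ[R] R ⧸ I, f ≠ 0}.Nonempty := by
    refine ⟨⊤, .of_equiv (Submodule.topEquiv (R := R) (M := R)).symm,
      I.mkQ ∘ₗ (⊤ : Submodule R R).subtype, fun h0 => ?_⟩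
    have := IsSimpleModule.nontrivial R (R ⧸ I)
    obtain ⟨x, hx⟩ := exists_ne (0 : R ⧸ I)
    obtain ⟨y, rfl⟩ := I.mkQ_surjective x
    exact hx (LinearMap.congr_fun h0 ⟨y, trivial⟩)
  obtain ⟨P, ⟨hP, π, hπ⟩, hmin⟩ := WellFounded.has_min (wellFounded_lt (α := Submodule R R)) _ hne
  have hπs := LinearMap.surjective_of_ne_zero hπ
  refine ⟨P, π, hP, hπs, fun N hN => ?_⟩
  have hNs : Function.Surjective (π ∘ₗ N.subtype) := by
    rw [← LinearMap.range_eq_top, LinearMap.range_comp, Submodule.range_subtype]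
    have := congrArg (Submodule.map π) hN
    rwa [Submodule.map_sup, LinearMap.le_ker_iff_map.1 le_rfl, sup_bot_eq, Submodule.map_top,
      LinearMap.range_eq_top.2 hπs] at this
  obtain ⟨g, hg⟩ := Module.projective_lifting_property _ π hNs
  -- Lifting `π` through its restriction to `N` gives an endomorphism of `P` with image in `N` and
  -- `π ∘ e = π`.
  let e : Module.End R P := N.subtype ∘ₗ g
  have he : ∀ k x, π ((e ^ k) x) = π x := fun k => by
    induction k with
    | zero => simp
    | succ k ih =>
      intro x
      rw [pow_succ, Module.End.mul_apply, ih]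
      exact LinearMap.congr_fun hg x
  -- By Fitting's lemma the range of a high power of `e` is a direct summand, hence projective, and
  -- `π` is nonzero on it. Positivity of `k` keeps the range inside `N`, so minimality of `P` gives
  -- `N = ⊤`.
  obtain ⟨k, hk, hk0⟩ := (e.eventually_isCompl_ker_pow_range_pow.and
    (Filter.eventually_gt_atTop 0)).exists
  let Q := LinearMap.range (e ^ k)
  have hQN : Q ≤ N := by
    rintro _ ⟨x, rfl⟩
    obtain ⟨k, rfl⟩ := Nat.exists_eq_succ_of_ne_zero hk0.ne'
    rw [pow_succ', Module.End.mul_apply]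
    exact (g _).2
  have hQ : Module.Projective R Q :=
    Module.Projective.of_split Q.subtype (Submodule.projectionOnto _ _ hk.symm)
      (LinearMap.ext fun x => Submodule.projectionOnto_apply_left hk.symm x)
  by_contra hNtop
  refine hmin (Q.map P.subtype) ⟨.of_equiv (Q.equivMapOfInjective _ P.subtype_injective), ?_⟩ ?_
  · refine ⟨π ∘ₗ Q.subtype ∘ₗ (Q.equivMapOfInjective _ P.subtype_injective).symm.toLinearMap,
      fun h0 => hπ ?_⟩
    ext x
    have := LinearMap.congr_fun h0 (Q.equivMapOfInjective _ P.subtype_injective ⟨_, x, rfl⟩)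
    simpa [he] using this
  · refine lt_of_le_of_ne (Submodule.map_subtype_le _ _) fun h => hNtop ?_
    rw [eq_top_iff]
    refine le_trans ?_ hQN
    intro x _
    have : (x : R) ∈ Q.map P.subtype := h.symm ▸ x.2
    simpa using this

end Covers

/-- Over an Artinian ring there are complete lists of simple modules and of their projective
covers. -/
theorem SimpleProjectiveList.nonempty (R : Type) [Ring R] [IsArtinianRing R] :
    Nonempty (SimpleProjectiveList R) := by
  obtain ⟨F, hF, hFS⟩ := IsFiniteLength.exists_finite_ideals.{0, 0, 0} (R := R) (M := R)
    (isFiniteLength_iff_isNoetherian_isArtinian.2 ⟨inferInstance, inferInstance⟩)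
  let F' := {I : Ideal R // I ∈ F ∧ IsSimpleModule R (R ⧸ I)}
  have : Finite F' := (hF.subset (s := F) (t := {I | I ∈ F ∧ IsSimpleModule R (R ⧸ I)})
    fun _ h => h.1).to_subtype
  -- One ideal is kept from each isomorphism class of simple quotients.
  let s : Setoid F' :=
    { r := fun I J => Nonempty ((R ⧸ I.1) ≃ₗ[R] R ⧸ J.1)
      iseqv := ⟨fun _ => ⟨.refl _ _⟩, fun ⟨e⟩ => ⟨e.symm⟩, fun ⟨e⟩ ⟨f⟩ => ⟨e.trans f⟩⟩ }
  obtain ⟨card, ⟨E⟩⟩ := Finite.exists_equiv_fin (Quotient s)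
  let ideal : Fin card → F' := fun i => (E.symm i).out
  have hsimple : ∀ i, IsSimpleModule R (R ⧸ (ideal i).1) := fun i => (ideal i).2.2
  choose P π hπ using fun i => exists_isProjectiveCover (ideal i).1 (hsimple i)
  have inj : ∀ i j, Nonempty ((R ⧸ (ideal i).1) ≃ₗ[R] R ⧸ (ideal j).1) → i = j := fun i j h => by
    have : (⟦ideal i⟧ : Quotient s) = ⟦ideal j⟧ := Quotient.sound h
    simpa [ideal] using this
  have complete : ∀ (M : Type) [AddCommGroup M] [Module R M], IsSimpleModule R M →
      ∃ i, Nonempty (M ≃ₗ[R] R ⧸ (ideal i).1) := fun M _ _ hM => by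
    have := IsSimpleModule.nontrivial R M
    obtain ⟨x, hx⟩ := exists_ne (0 : M)
    obtain ⟨I, hI, ⟨e⟩⟩ := hFS M hM (LinearMap.toSpanSingleton R M x)
      (fun h0 => hx (by simpa using LinearMap.congr_fun h0 1))
    have hIs : IsSimpleModule R (R ⧸ I) := .congr e.symm
    obtain ⟨f⟩ : s.r ⟨I, hI, hIs⟩ (ideal (E ⟦⟨I, hI, hIs⟩⟧)) := by
      refine Quotient.exact (s := s) ?_
      simp [ideal]
    exact ⟨_, ⟨e.trans f⟩⟩
  exact ⟨{
    card := card
    S := fun i => .of R (R ⧸ (ideal i).1)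
    P := fun i => .of R (P i)
    simple := hsimple
    simple_inj := inj
    simple_complete := complete
    finite := fun i => inferInstanceAs (Module.Finite R (P i))
    projective := fun i => (hπ i).1
    indecomposable := fun i => (hπ i).isIndecomposableModule
    projective_inj := fun i j ⟨e⟩ => inj i j <| by
      refine (hπ i).nonempty_equiv (f := π j ∘ₗ e.toLinearMap) fun h0 => ?_
      have := IsSimpleModule.nontrivial R (R ⧸ (ideal j).1)
      obtain ⟨x, hx⟩ := exists_ne (0 : R ⧸ (ideal j).1)
      obtain ⟨y, rfl⟩ := ((hπ j).2.1.comp e.surjective) x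
      exact hx (LinearMap.congr_fun h0 y)
    projective_complete := fun M _ _ _ _ hM => by
      have := hM.1
      -- A nonzero finite module has a maximal submodule; the simple quotient selects the index of
      -- the cover.
      obtain ⟨m, hm⟩ := IsCoatomic.exists_coatom (Submodule R M)
      obtain ⟨i, ⟨e⟩⟩ := complete (M ⧸ m) (isSimpleModule_iff_isCoatom.2 hm)
      refine ⟨i, (hπ i).nonempty_equiv_of_indecomposable hM
        (q := e.toLinearMap ∘ₗ m.mkQ) fun h0 => hm.1 ?_⟩
      rw [eq_top_iff]
      intro x _
      have := LinearMap.congr_fun h0 x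
      simpa using this
    cover := fun i => ⟨π i, hπ i⟩ }⟩

/-! ### Additive functions on modules of finite length -/

section Additive

/-- A function on modules that is additive on short exact sequences of finite modules. -/
def IsAdditiveFunction {A : Type} [Ring A] (F : ModuleCat.{0} A → ℕ) : Prop :=
  ∀ (X Y Z : ModuleCat.{0} A) (f : X →ₗ[A] Y) (g : Y →ₗ[A] Z), Function.Injective f →
    Function.Surjective g → Function.Exact f g → Module.Finite A Y → F Y = F X + F Z

namespace IsAdditiveFunction

variable {A : Type} [Ring A] {F G : ModuleCat.{0} A → ℕ}

theorem eq_zero (hF : IsAdditiveFunction F) (X : ModuleCat.{0} A) [Subsingleton X] : F X = 0 := by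
  have := hF X X X LinearMap.id LinearMap.id Function.injective_id Function.surjective_id
    (fun x => by simp [Subsingleton.elim x 0]) inferInstance
  omega

theorem congr (hF : IsAdditiveFunction F) {X Y : ModuleCat.{0} A} (e : X ≃ₗ[A] Y)
    [Module.Finite A Y] : F X = F Y := by
  have := hF X Y (.of A PUnit) e.toLinearMap 0 e.injective
    (fun x => ⟨0, Subsingleton.elim _ _⟩) (fun y => by simp) inferInstance
  rw [this, hF.eq_zero (.of A PUnit), add_zero]

theorem sum_mul {ι : Type*} (s : Finset ι) (H : ι → ModuleCat.{0} A → ℕ) (c : ι → ℕ)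
    (hH : ∀ i, IsAdditiveFunction (H i)) : IsAdditiveFunction fun X => ∑ i ∈ s, H i X * c i :=
  fun X Y Z f g hf hg h hY => by
    simp only [fun i => hH i X Y Z f g hf hg h hY, add_mul, Finset.sum_add_distrib]

/-- Additive functions that agree on simple modules agree on modules of finite length. -/
theorem eq_of_simple (hF : IsAdditiveFunction F) (hG : IsAdditiveFunction G)
    (h : ∀ S : ModuleCat.{0} A, IsSimpleModule A S → F S = G S) {M : Type} [AddCommGroup M]
    [Module A M] (hM : IsFiniteLength A M) : F (.of A M) = G (.of A M) := by
  induction hM with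
  | @of_subsingleton M _ _ _ =>
    have : Subsingleton (ModuleCat.of A M) := ‹Subsingleton M›
    rw [hF.eq_zero, hG.eq_zero]
  | @of_simple_quotient M _ _ N hN hlen ih =>
    have hfin : Module.Finite A M :=
      have := (isFiniteLength_iff_isNoetherian_isArtinian.1
        (IsFiniteLength.of_simple_quotient (N := N) hlen)).1
      inferInstance
    have key : ∀ {F : ModuleCat.{0} A → ℕ}, IsAdditiveFunction F →
        F (.of A M) = F (.of A N) + F (.of A (M ⧸ N)) := fun hF =>
      hF (.of A N) (.of A M) (.of A (M ⧸ N)) N.subtype N.mkQ N.subtype_injective N.mkQ_surjective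
        (LinearMap.exact_subtype_mkQ N) hfin
    rw [key hF, key hG, ih, h _ hN]

end IsAdditiveFunction

variable {A : Type*} [Ring A] [Algebra ℂ A]
  {P X Y Z : Type*} [AddCommGroup P] [AddCommGroup X] [AddCommGroup Y] [AddCommGroup Z]
  [Module A P] [Module A X] [Module A Y] [Module A Z]
  [Module ℂ P] [Module ℂ X] [Module ℂ Y] [Module ℂ Z]
  [IsScalarTower ℂ A P] [IsScalarTower ℂ A X] [IsScalarTower ℂ A Y] [IsScalarTower ℂ A Z]

variable (A P Y) in
theorem finiteDimensional_hom [Module.Finite ℂ P] [Module.Finite ℂ Y] :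
    Module.Finite ℂ (P →ₗ[A] Y) :=
  Module.Finite.of_injective (LinearMap.restrictScalarsₗ ℂ A P Y ℂ)
    (LinearMap.restrictScalars_injective ℂ)

/-- Composition with a fixed homomorphism, as a linear map between spaces of homomorphisms. -/
def postcompLinear (P : Type*) [AddCommGroup P] [Module A P] (g : Y →ₗ[A] Z) :
    (P →ₗ[A] Y) →ₗ[ℂ] (P →ₗ[A] Z) where
  toFun f := g ∘ₗ f
  map_add' _ _ := LinearMap.comp_add _ _ _
  map_smul' c f := by
    ext x
    exact LinearMap.map_smul_of_tower g c (f x)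

/-- Homomorphisms out of a projective module form an exact functor. -/
theorem finrank_hom_eq_add [Module.Projective A P] [Module.Finite ℂ P] [Module.Finite ℂ Y]
    {f : X →ₗ[A] Y} {g : Y →ₗ[A] Z} (hf : Function.Injective f) (hg : Function.Surjective g)
    (h : Function.Exact f g) :
    Module.finrank ℂ (P →ₗ[A] Y) = Module.finrank ℂ (P →ₗ[A] X) + Module.finrank ℂ (P →ₗ[A] Z) := by
  have := finiteDimensional_hom A P Y
  have hinj : Function.Injective (postcompLinear P f) := fun a b hab => by
    ext x
    exact hf (LinearMap.congr_fun hab x)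
  have hsurj : LinearMap.range (postcompLinear P g) = ⊤ :=
    LinearMap.range_eq_top.2 fun q => Module.projective_lifting_property g q hg
  have hker : LinearMap.ker (postcompLinear P g) = LinearMap.range (postcompLinear P f) := by
    ext q
    constructor
    · intro hq
      have hq' : ∀ x, q x ∈ LinearMap.range f := fun x => (h _).1 (LinearMap.congr_fun hq x)
      refine ⟨(LinearEquiv.ofInjective f hf).symm.toLinearMap ∘ₗ q.codRestrict _ hq', ?_⟩
      ext x
      exact congrArg Subtype.val
        ((LinearEquiv.ofInjective f hf).apply_symm_apply ⟨q x, hq' x⟩)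
    · rintro ⟨q, rfl⟩
      ext x
      exact h.apply_apply_eq_zero (q x)
  rw [← LinearMap.finrank_range_add_finrank_ker (postcompLinear P g), hsurj, finrank_top, hker,
    LinearMap.finrank_range_of_inj hinj, add_comm]

end Additive

/-! ### Homomorphisms from projective covers to simple modules. -/

namespace SimpleProjectiveList

variable {A : Type} [Ring A] (L : SimpleProjectiveList A)

theorem hom_eq_zero {i j : Fin L.card} (hij : i ≠ j) (f : L.P i →ₗ[A] L.S j) : f = 0 := by
  by_contra hf
  have := L.simple i
  have := L.simple j
  obtain ⟨π, hπ⟩ := L.cover i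
  exact hij (L.simple_inj i j (hπ.nonempty_equiv hf))

/-- A map `P_i → S_i` kills `ker π`, so it is `π` followed by an endomorphism of `S_i`, which is a
scalar by Schur's lemma over `ℂ`. For `i ≠ j` the uniqueness of the simple quotient of `P_i` leaves
only zero. -/
theorem finrank_hom [Algebra ℂ A] [∀ i, Module ℂ (L.S i)] [∀ i, IsScalarTower ℂ A (L.S i)]
    [∀ i, Module.Finite ℂ (L.S i)] (i j : Fin L.card) :
    Module.finrank ℂ (L.P i →ₗ[A] L.S j) = if i = j then 1 else 0 := by
  split_ifs with hij
  · subst hij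
    have := L.simple i
    obtain ⟨π, hπ⟩ := L.cover i
    have hπ0 : π ≠ 0 := fun h0 => by
      have := IsSimpleModule.nontrivial A (L.S i)
      obtain ⟨x, hx⟩ := exists_ne (0 : L.S i)
      obtain ⟨y, rfl⟩ := hπ.2.1 x
      exact hx (LinearMap.congr_fun h0 y)
    rw [finrank_eq_one_iff_of_nonzero' π hπ0]
    intro f
    have hle : LinearMap.ker π ≤ LinearMap.ker f := by
      by_cases hf : f = 0
      · simp [hf]
      · have hco := LinearMap.isCoatom_ker_of_surjective (LinearMap.surjective_of_ne_zero hf)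
        have hco' := LinearMap.isCoatom_ker_of_surjective hπ.2.1
        exact ((hco.le_iff_eq hco'.1).1 (hπ.le_ker hco.1)).le
    let g : Module.End A (L.S i) :=
      (LinearMap.ker π).liftQ f hle ∘ₗ (π.quotKerEquivOfSurjective hπ.2.1).symm.toLinearMap
    have hg : ∀ x, g (π x) = f x := fun x => by
      have : (π.quotKerEquivOfSurjective hπ.2.1).symm (π x) = (LinearMap.ker π).mkQ x := by
        rw [LinearEquiv.symm_apply_eq]
        rfl
      simp [g, this]
    obtain ⟨c, hc⟩ := (IsSimpleModule.algebraMap_end_bijective_of_isAlgClosed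
      (A := A) (V := L.S i) ℂ).2 g
    refine ⟨c, LinearMap.ext fun x => ?_⟩
    rw [← hg, ← hc]
    rfl
  · have : Subsingleton (L.P i →ₗ[A] L.S j) :=
      ⟨fun f g => by rw [L.hom_eq_zero hij f, L.hom_eq_zero hij g]⟩
    exact Module.finrank_zero_of_subsingleton

end SimpleProjectiveList

namespace Hecke

/-! ### Generators and linear maps -/

section Generators

variable {m n N : ℕ} {v : ℂ}

/-- The generators of `H_n(v)`, indexed by natural numbers and extended by `0`. -/
def gen (n : ℕ) (v : ℂ) (j : ℕ) : Hecke n v :=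
  if h : j < n - 1 then T v ⟨j, h⟩ else 0

theorem gen_of_lt {j : ℕ} (h : j < n - 1) : gen n v j = T v ⟨j, h⟩ := dif_pos h

theorem T_eq_gen (i : Fin (n - 1)) : (T v i : Hecke n v) = gen n v i := by
  rw [gen_of_lt i.isLt]

theorem gen_quad {j : ℕ} (h : j < n - 1) :
    gen n v j * gen n v j = (v - 1) • gen n v j + algebraMap ℂ _ v := by
  rw [gen_of_lt h, T_quad]

theorem gen_comm {i j : ℕ} (h : i + 1 < j ∨ j + 1 < i) :
    gen n v i * gen n v j = gen n v j * gen n v i := by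
  by_cases hi : i < n - 1
  · by_cases hj : j < n - 1
    · rw [gen_of_lt hi, gen_of_lt hj]
      exact T_comm _ _ h
    · simp [gen, hj]
  · simp [gen, hi]

theorem gen_braid {i : ℕ} (h : i + 1 < n - 1) :
    gen n v i * gen n v (i + 1) * gen n v i = gen n v (i + 1) * gen n v i * gen n v (i + 1) := by
  rw [gen_of_lt h, gen_of_lt (show i < n - 1 by omega)]
  exact T_braid _ _ rfl

theorem shift_gen (k : ℕ) (h : k + n ≤ N) {i : ℕ} (hi : i < n - 1) :
    shift v k h (gen n v i) = gen N v (k + i) := by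
  rw [gen_of_lt hi, shift_T, gen_of_lt]

/-- A subspace of a module that is stable under the generators is a submodule. -/
theorem smul_mem_of_gen {M : Type*} [AddCommGroup M] [Module (Hecke n v) M] [Module ℂ M]
    [IsScalarTower ℂ (Hecke n v) M] (W : Submodule ℂ M)
    (h : ∀ i < n - 1, ∀ x ∈ W, gen n v i • x ∈ W) (a : Hecke n v) {x : M} (hx : x ∈ W) :
    a • x ∈ W := by
  obtain ⟨y, rfl⟩ := mk_surjective a
  induction y using FreeAlgebra.induction generalizing x with
  | grade0 c =>
    rw [AlgHom.commutes, algebraMap_smul]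
    exact W.smul_mem c hx
  | grade1 i =>
    rw [show mk n v (FreeAlgebra.ι ℂ i) = T v i from rfl, T_eq_gen]
    exact h i i.isLt x hx
  | mul a b ha hb =>
    rw [map_mul, mul_smul]
    exact ha (hb hx)
  | add a b ha hb =>
    rw [map_add, add_smul]
    exact W.add_mem (ha hx) (hb hx)

/-- A complex linear map that commutes with the generators is a homomorphism of modules. -/
def homOfGen {M M' : Type*} [AddCommGroup M] [Module (Hecke n v) M] [Module ℂ M]
    [IsScalarTower ℂ (Hecke n v) M] [AddCommGroup M'] [Module (Hecke n v) M'] [Module ℂ M']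
    [IsScalarTower ℂ (Hecke n v) M'] (f : M →ₗ[ℂ] M')
    (h : ∀ i < n - 1, ∀ x, f (gen n v i • x) = gen n v i • f x) : M →ₗ[Hecke n v] M' where
  toFun := f
  map_add' := f.map_add
  map_smul' a x := by
    obtain ⟨y, rfl⟩ := mk_surjective a
    induction y using FreeAlgebra.induction generalizing x with
    | grade0 c => simp
    | grade1 i =>
      rw [show mk n v (FreeAlgebra.ι ℂ i) = T v i from rfl, T_eq_gen]
      exact h i i.isLt x
    | mul a b ha hb =>
      rw [map_mul, mul_smul, ha, hb]
      simp [mul_smul]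
    | add a b ha hb =>
      rw [map_add, add_smul, map_add, ha, hb]
      simp [add_smul]

end Generators

/-! ### Coset representatives -/

section Cosets

variable {n N : ℕ} {v : ℂ}

/-- The product `T_{k-1} ⋯ T_0`. -/
def cosetRep (N : ℕ) (v : ℂ) : ℕ → Hecke N v
  | 0 => 1
  | k + 1 => gen N v k * cosetRep N v k

theorem gen_mul_cosetRep_of_lt {i k : ℕ} (h : k < i) :
    gen N v i * cosetRep N v k = cosetRep N v k * gen N v i := by
  induction k with
  | zero => simp [cosetRep]
  | succ k ih =>
    rw [cosetRep, ← mul_assoc, gen_comm (by omega), mul_assoc, ih (by omega), mul_assoc]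

/-- The braid relation turns `T_i T_{i+1} T_i` into `T_{i+1} T_i T_{i+1}`, whose last factor passes
the shorter product to its right; the factors `T_j` with `j > i + 1` commute with `T_i`. -/
theorem gen_mul_cosetRep_of_gt {i k : ℕ} (h : i + 1 < k) (hk : k ≤ N - 1) :
    gen N v i * cosetRep N v k = cosetRep N v k * gen N v (i + 1) := by
  induction k, h using Nat.le_induction with
  | base =>
    rw [cosetRep, cosetRep, ← mul_assoc, ← mul_assoc, gen_braid (by omega), mul_assoc,
      gen_mul_cosetRep_of_lt (by omega)]
    simp only [mul_assoc]
  | succ k hik ih =>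
    rw [cosetRep, ← mul_assoc, gen_comm (by omega), mul_assoc, ih (by omega), mul_assoc]

theorem gen_mul_cosetRep_succ {k : ℕ} (h : k < N - 1) :
    gen N v k * cosetRep N v (k + 1) = (v - 1) • cosetRep N v (k + 1) + v • cosetRep N v k := by
  rw [cosetRep, ← mul_assoc, gen_quad h, add_mul, smul_mul_assoc, ← Algebra.smul_def]

/-- The span of the translates of a submodule over the subalgebra `H_n(v)` under the coset
representatives is a submodule. -/
theorem exists_sum_cosetRep (h : 1 + n = N) {M Z : Type*} [AddCommGroup M]
    [Module (Hecke n v) M] [Module ℂ M] [IsScalarTower ℂ (Hecke n v) M] [AddCommGroup Z]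
    [Module (Hecke N v) Z] [Module ℂ Z] [IsScalarTower ℂ (Hecke N v) Z] (q : M →ₗ[ℂ] Z)
    (hq : ∀ c x, q (c • x) = shift v 1 h.le c • q x) (a : Hecke N v) (x : M) :
    ∃ y : Fin (n + 1) → M, ∑ k : Fin (n + 1), cosetRep N v k • q (y k) = a • q x := by
  let B : (Fin (n + 1) → M) →ₗ[ℂ] Z :=
    { toFun := fun y => ∑ k : Fin (n + 1), cosetRep N v k • q (y k)
      map_add' := fun y z => by simp [smul_add, Finset.sum_add_distrib]
      map_smul' := fun c y => by
        simp only [Pi.smul_apply, map_smul, Finset.smul_sum, RingHom.id_apply]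
        exact Finset.sum_congr rfl fun k _ => smul_comm _ _ _ }
  have hB : ∀ k ≤ n, ∀ x, cosetRep N v k • q x ∈ LinearMap.range B := fun k hk x => by
    refine ⟨Pi.single ⟨k, by omega⟩ x, ?_⟩
    change ∑ j : Fin (n + 1), cosetRep N v j • q ((Pi.single ⟨k, by omega⟩ x : Fin (n + 1) → M) j) = _
    rw [Finset.sum_eq_single ⟨k, by omega⟩]
    · simp
    · intro j _ hj
      simp [Pi.single_eq_of_ne hj]
    · simp
  refine smul_mem_of_gen (LinearMap.range B) ?_ a (by simpa [cosetRep] using hB 0 (by omega) x)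
  rintro i hi _ ⟨y, rfl⟩
  change _ • (∑ k : Fin (n + 1), cosetRep N v k • q (y k)) ∈ _
  rw [Finset.smul_sum]
  refine Submodule.sum_mem _ fun k _ => ?_
  obtain ⟨k, hk⟩ := k
  simp only [smul_smul]
  generalize y ⟨k, hk⟩ = x
  -- For `k < i` or `k > i + 1`, `T_i` passes the representative and emerges as `T_i` or `T_{i+1}`,
  -- in the image of `shift`, and is absorbed into `q`. For `k = i` it produces the next
  -- representative, for `k = i + 1` the quadratic relation applies.
  rcases lt_trichotomy k i with hki | rfl | hki
  · obtain ⟨i, rfl⟩ := Nat.exists_eq_succ_of_ne_zero (show i ≠ 0 by omega)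
    rw [gen_mul_cosetRep_of_lt hki, mul_smul, Nat.succ_eq_one_add,
      ← shift_gen 1 h.le (by omega), ← hq]
    exact hB _ (by omega) _
  · exact hB (k + 1) (by omega) _
  · rcases Nat.lt_or_eq_of_le (Nat.succ_le_of_lt hki) with hki | rfl
    · rw [gen_mul_cosetRep_of_gt hki (by omega), mul_smul, add_comm i,
        ← shift_gen 1 h.le (by omega), ← hq]
      exact hB _ (by omega) _
    · rw [gen_mul_cosetRep_succ hi, add_smul, smul_assoc, smul_assoc]
      exact add_mem (Submodule.smul_mem _ _ (hB _ (by omega) _))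
        (Submodule.smul_mem _ _ (hB _ (by omega) _))

/-- There are no generators, so the line of scalars is already a left ideal containing `1`. -/
theorem algebraMap_surjective_of_le_one (hn : n ≤ 1) :
    Function.Surjective (algebraMap ℂ (Hecke n v)) := fun a => by
  have := smul_mem_of_gen (M := Hecke n v) (LinearMap.range (Algebra.linearMap ℂ (Hecke n v)))
    (fun i hi => by omega) a (x := 1) ⟨1, by simp⟩
  simpa using this

/-- Induction on `n`: finitely many translates of the image of `H_n` span `H_{n+1}`. -/
instance finiteDimensional (n : ℕ) (v : ℂ) : Module.Finite ℂ (Hecke n v) := by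
  induction n with
  | zero =>
    exact Module.Finite.of_surjective (Algebra.linearMap ℂ (Hecke 0 v))
      (algebraMap_surjective_of_le_one (by omega))
  | succ n ih =>
    have h : 1 + n = n + 1 := add_comm _ _
    have key := exists_sum_cosetRep (v := v) h (shift v 1 h.le).toLinearMap
      (fun c x => by simp)
    let B : (Fin (n + 1) → Hecke n v) →ₗ[ℂ] Hecke (n + 1) v :=
      ∑ k : Fin (n + 1), LinearMap.mulLeft ℂ (cosetRep (n + 1) v k) ∘ₗ
        (shift v 1 h.le).toLinearMap ∘ₗ LinearMap.proj k
    refine Module.Finite.of_surjective B fun a => ?_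
    obtain ⟨y, hy⟩ := key a 1
    exact ⟨y, by simpa [B] using hy⟩

instance isArtinianRing (n : ℕ) (v : ℂ) : IsArtinianRing (Hecke n v) :=
  IsArtinianRing.of_finite ℂ _

end Cosets

/-! ### A model of the induced module -/

section Model

variable {n N : ℕ} {v : ℂ} {M : Type*} [AddCommGroup M] [Module (Hecke n v) M] [Module ℂ M]
  [IsScalarTower ℂ (Hecke n v) M]

/-- The action of `T_i` on `⊕ₖ (T_{k-1} ⋯ T_0) ⊗ M`. -/
def indOp (n : ℕ) (v : ℂ) (M : Type*) [AddCommGroup M] [Module (Hecke n v) M] [Module ℂ M]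
    [IsScalarTower ℂ (Hecke n v) M] (i : ℕ) (hi : i < n) :
    (Fin (n + 1) → M) →ₗ[ℂ] (Fin (n + 1) → M) where
  toFun x k :=
    -- These are the straightening rules for `T_i` times a representative, read off in coordinates.
    -- In the first case `i > 0`, and in the last `i < n - 1`, so no junk value of `i - 1` or `gen`
    -- is met.
    if (k : ℕ) < i then gen n v (i - 1) • x k
    else if (k : ℕ) = i then v • x ⟨i + 1, by omega⟩
    else if (k : ℕ) = i + 1 then x ⟨i, by omega⟩ + (v - 1) • x k
    else gen n v i • x k
  map_add' x y := by
    ext k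
    simp only [Pi.add_apply]
    split_ifs
    · simp
    · simp
    · module
    · simp
  map_smul' c x := by
    ext k
    simp only [Pi.smul_apply, RingHom.id_apply]
    split_ifs
    · exact smul_comm _ _ _
    · exact smul_comm _ _ _
    · module
    · exact smul_comm _ _ _

theorem indOp_of_lt {i k : ℕ} (hi : i < n) (hk : k < n + 1) (hki : k < i) (x : Fin (n + 1) → M) :
    indOp n v M i hi x ⟨k, hk⟩ = gen n v (i - 1) • x ⟨k, hk⟩ := by
  simp [indOp, hki]

theorem indOp_self {i : ℕ} (hi : i < n) (hk : i < n + 1) (x : Fin (n + 1) → M) :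
    indOp n v M i hi x ⟨i, hk⟩ = v • x ⟨i + 1, by omega⟩ := by
  simp [indOp]

theorem indOp_succ {i : ℕ} (hi : i < n) (hk : i + 1 < n + 1) (x : Fin (n + 1) → M) :
    indOp n v M i hi x ⟨i + 1, hk⟩ = x ⟨i, by omega⟩ + (v - 1) • x ⟨i + 1, hk⟩ := by
  simp [indOp]

theorem indOp_of_gt {i k : ℕ} (hi : i < n) (hk : k < n + 1) (hki : i + 1 < k)
    (x : Fin (n + 1) → M) : indOp n v M i hi x ⟨k, hk⟩ = gen n v i • x ⟨k, hk⟩ := by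
  simp [indOp, show ¬ k < i by omega, show k ≠ i by omega, show k ≠ i + 1 by omega]

theorem gen_smul_gen_smul {j : ℕ} (h : j < n - 1) (x : M) :
    gen n v j • gen n v j • x = (v - 1) • gen n v j • x + v • x := by
  rw [smul_smul, gen_quad h, add_smul, smul_assoc, algebraMap_smul]

theorem indOp_quad {i : ℕ} (hi : i < n) (x : Fin (n + 1) → M) :
    indOp n v M i hi (indOp n v M i hi x) = (v - 1) • indOp n v M i hi x + v • x := by
  ext ⟨k, hk⟩
  simp only [Pi.add_apply, Pi.smul_apply]
  rcases lt_trichotomy k i with hki | rfl | hki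
  · simp (disch := omega) only [indOp_of_lt]
    exact gen_smul_gen_smul (by omega) _
  · simp only [indOp_self, indOp_succ]
    module
  · rcases Nat.lt_or_eq_of_le (Nat.succ_le_of_lt hki) with hki | rfl
    · simp (disch := omega) only [indOp_of_gt]
      exact gen_smul_gen_smul (by omega) _
    · simp only [Nat.succ_eq_add_one, indOp_self, indOp_succ]
      module

/-- The coordinate pairs `{i, i+1}` and `{j, j+1}` that the operators mix are disjoint; elsewhere
both act by generators of `H_n` that commute. -/
theorem indOp_comm {i j : ℕ} (hi : i < n) (hj : j < n) (hij : i + 1 < j) (x : Fin (n + 1) → M) :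
    indOp n v M i hi (indOp n v M j hj x) = indOp n v M j hj (indOp n v M i hi x) := by
  ext ⟨k, hk⟩
  have hc : ∀ {a b : ℕ} (_ : a + 1 < b ∨ b + 1 < a) (y : M),
      gen n v a • gen n v b • y = gen n v b • gen n v a • y := fun h y => by
    rw [smul_smul, gen_comm h, mul_smul]
  have hs : ∀ (a : ℕ) (c : ℂ) (y : M), gen n v a • c • y = c • gen n v a • y :=
    fun a c y => smul_comm _ _ _
  rcases lt_trichotomy k i with hki | rfl | hki
  · simp (disch := omega) only [indOp_of_lt]
    exact hc (by omega) _
  · simp (disch := omega) only [indOp_self, indOp_of_lt, hs]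
  rcases Nat.lt_or_eq_of_le (Nat.succ_le_of_lt hki) with hki | rfl
  swap
  · simp (disch := omega) only [Nat.succ_eq_add_one, indOp_succ, indOp_of_lt, hs, smul_add]
  rcases lt_trichotomy k j with hkj | rfl | hkj
  · simp (disch := omega) only [indOp_of_lt, indOp_of_gt]
    exact hc (by omega) _
  · simp (disch := omega) only [indOp_self, indOp_of_gt, hs]
  rcases Nat.lt_or_eq_of_le (Nat.succ_le_of_lt hkj) with hkj | rfl
  · simp (disch := omega) only [indOp_of_gt]
    exact hc (by omega) _
  · simp (disch := omega) only [Nat.succ_eq_add_one, indOp_succ, indOp_of_gt, hs, smul_add]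

/-- Outside the coordinates `i`, `i+1`, `i+2` this is a braid relation in `H_n`. On those three it
is a direct computation, which needs the quadratic relation of `H_n` only at `i+2`. -/
theorem indOp_braid {i : ℕ} (hi : i < n) (hi' : i + 1 < n) (x : Fin (n + 1) → M) :
    indOp n v M i hi (indOp n v M (i + 1) hi' (indOp n v M i hi x)) =
      indOp n v M (i + 1) hi' (indOp n v M i hi (indOp n v M (i + 1) hi' x)) := by
  ext ⟨k, hk⟩
  have hb : ∀ {a : ℕ} (_ : a + 1 < n - 1) (y : M),
      gen n v a • gen n v (a + 1) • gen n v a • y =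
        gen n v (a + 1) • gen n v a • gen n v (a + 1) • y := fun h y => by
    simp only [smul_smul]
    rw [← mul_assoc, gen_braid h, mul_assoc]
  have hs : ∀ (a : ℕ) (c : ℂ) (y : M), gen n v a • c • y = c • gen n v a • y :=
    fun a c y => smul_comm _ _ _
  have hq := gen_smul_gen_smul (M := M) (v := v) (show i < n - 1 by omega)
  rcases lt_or_ge k i with hki | hki
  · obtain ⟨i, rfl⟩ := Nat.exists_eq_succ_of_ne_zero (show i ≠ 0 by omega)
    simp (disch := omega) only [indOp_of_lt, Nat.succ_eq_add_one, Nat.add_sub_cancel]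
    exact hb (by omega) _
  rcases lt_or_ge (i + 2) k with hki' | hki'
  · simp (disch := omega) only [indOp_of_gt]
    exact hb (by omega) _
  -- Hiding the action of `T_i` behind a bare function makes its values atoms for `module`, leaving
  -- only complex scalars.
  obtain ⟨g, hg⟩ : ∃ g : M → M, ∀ y, gen n v i • y = g y := ⟨_, fun _ => rfl⟩
  obtain rfl | rfl | rfl : k = i ∨ k = i + 1 ∨ k = i + 1 + 1 := by omega
  · simp (disch := omega) only [indOp_self, indOp_of_lt, indOp_of_gt, Nat.add_sub_cancel, hs]
  · simp (disch := omega) only [indOp_self, indOp_succ, indOp_of_lt, indOp_of_gt,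
      Nat.add_sub_cancel, hs, smul_add]
    simp only [hg]
    module
  · simp (disch := omega) only [indOp_self, indOp_succ, indOp_of_lt, indOp_of_gt,
      Nat.add_sub_cancel, hs, smul_add, hq]
    simp only [hg]
    module

/-- The action of `H_{n+1}(v)` on the model of the induced module. -/
def indAction (h : 1 + n = N) (v : ℂ) (M : Type*) [AddCommGroup M] [Module (Hecke n v) M]
    [Module ℂ M] [IsScalarTower ℂ (Hecke n v) M] :
    Hecke N v →ₐ[ℂ] Module.End ℂ (Fin (n + 1) → M) :=
  lift (FreeAlgebra.lift ℂ fun i : Fin (N - 1) =>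
    (indOp n v M i (by have := i.isLt; omega) : Module.End ℂ (Fin (n + 1) → M))) <| by
      rintro _ _ (i | ⟨i, j, hij⟩ | ⟨⟨i, hi⟩, ⟨j, hj⟩, hij⟩)
      · refine LinearMap.ext fun x => ?_
        simpa [Algebra.algebraMap_eq_smul_one] using indOp_quad _ x
      · refine LinearMap.ext fun x => ?_
        rcases hij with hij | hij
        · simpa using indOp_comm _ _ hij x
        · simpa using (indOp_comm _ _ hij x).symm
      · obtain rfl : j = i + 1 := hij
        refine LinearMap.ext fun x => ?_
        simpa using indOp_braid _ _ x

theorem indAction_gen (h : 1 + n = N) {i : ℕ} (hi : i < N - 1) :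
    indAction h v M (gen N v i) = indOp n v M i (by omega) := by
  rw [gen_of_lt hi]
  simp [indAction, T, lift_mk]

end Model

/-! ### Restriction and induction: exactness and the two Mackey components. -/

section Functors

variable {n N : ℕ} {v : ℂ}

/-- The restriction of an `H_{n+1}(v)`-module along `T_i ↦ T_{i+1}`. -/
def res (h : 1 + n = N) (M : ModuleCat.{0} (Hecke N v)) : ModuleCat.{0} (Hecke n v) :=
  @ModuleCat.of _ _ M _ (Module.compHom M (shift v 1 h.le).toRingHom)

/-- The model of the module induced along `T_i ↦ T_{i+1}`. -/
def indModel (h : 1 + n = N) (M : ModuleCat.{0} (Hecke n v)) : ModuleCat.{0} (Hecke N v) :=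
  @ModuleCat.of _ _ (Fin (n + 1) → M) _ (Module.compHom _ (indAction h v M).toRingHom)

/-- The identity map from a module to its restriction. -/
def toRes (h : 1 + n = N) (M : ModuleCat.{0} (Hecke N v)) : M ≃ₗ[ℂ] res h M where
  toFun x := x
  invFun x := x
  map_add' _ _ := rfl
  map_smul' c x := by
    change algebraMap ℂ (Hecke N v) c • x = shift v 1 h.le (algebraMap ℂ (Hecke n v) c) • x
    rw [AlgHom.commutes]
  left_inv _ := rfl
  right_inv _ := rfl

theorem smul_toRes (h : 1 + n = N) (M : ModuleCat.{0} (Hecke N v)) (a : Hecke n v) (x : M) :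
    a • toRes h M x = toRes h M (shift v 1 h.le a • x) := rfl

/-- The vector with coordinates `x` in the model of the induced module. -/
def toInd (h : 1 + n = N) (M : ModuleCat.{0} (Hecke n v)) :
    (Fin (n + 1) → M) ≃ₗ[ℂ] indModel h M where
  toFun x := x
  invFun x := x
  map_add' _ _ := rfl
  map_smul' c x := by
    change c • x = indAction h v M (algebraMap ℂ (Hecke N v) c) x
    rw [AlgHom.commutes]
    rfl
  left_inv _ := rfl
  right_inv _ := rfl

theorem gen_smul_toInd (h : 1 + n = N) (M : ModuleCat.{0} (Hecke n v)) {i : ℕ} (hi : i < N - 1)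
    (x : Fin (n + 1) → M) :
    gen N v i • toInd h M x = toInd h M (indOp n v M i (by omega) x) := by
  rw [← indAction_gen h hi]
  rfl

instance finite_complex (M : ModuleCat.{0} (Hecke n v)) [Module.Finite (Hecke n v) M] :
    Module.Finite ℂ M :=
  Module.Finite.trans (Hecke n v) M

instance finite_res (h : 1 + n = N) (M : ModuleCat.{0} (Hecke N v))
    [Module.Finite (Hecke N v) M] : Module.Finite (Hecke n v) (res h M) :=
  have : Module.Finite ℂ (res h M) := .equiv (toRes h M)
  .of_restrictScalars_finite ℂ _ _

instance finite_indModel (h : 1 + n = N) (M : ModuleCat.{0} (Hecke n v))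
    [Module.Finite (Hecke n v) M] : Module.Finite (Hecke N v) (indModel h M) :=
  have : Module.Finite ℂ (indModel h M) := .equiv (toInd h M)
  .of_restrictScalars_finite ℂ _ _

/-- Restriction of homomorphisms. -/
def resMap (h : 1 + n = N) {M M' : ModuleCat.{0} (Hecke N v)} (f : M →ₗ[Hecke N v] M') :
    res h M →ₗ[Hecke n v] res h M' where
  toFun x := toRes h M' (f ((toRes h M).symm x))
  map_add' x y := by simp
  map_smul' a x := by
    obtain ⟨x, rfl⟩ := (toRes h M).surjective x
    simp [smul_toRes]

/-- Induction of homomorphisms. -/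
def indMap (h : 1 + n = N) {M M' : ModuleCat.{0} (Hecke n v)} (f : M →ₗ[Hecke n v] M') :
    indModel h M →ₗ[Hecke N v] indModel h M' :=
  homOfGen ((toInd h M').toLinearMap ∘ₗ (LinearMap.restrictScalars ℂ f).compLeft _ ∘ₗ
      (toInd h M).symm.toLinearMap) fun i hi x => by
    obtain ⟨x, rfl⟩ := (toInd h M).surjective x
    simp only [gen_smul_toInd h _ hi, LinearMap.comp_apply, LinearEquiv.coe_coe,
      LinearEquiv.symm_apply_apply]
    congr 1
    ext k
    simp only [indOp, LinearMap.coe_mk, AddHom.coe_mk, LinearMap.compLeft_apply,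
      Function.comp_apply, LinearMap.coe_restrictScalars]
    split_ifs <;> simp

theorem isAdditiveFunction_pairing (P : ModuleCat.{0} (Hecke n v))
    [Module.Projective (Hecke n v) P] [Module.Finite (Hecke n v) P] :
    IsAdditiveFunction (pairing P) := fun _ _ _ _ _ hf hg h _ =>
  finrank_hom_eq_add hf hg h

theorem isAdditiveFunction_pairing_res (h : 1 + n = N) (P : ModuleCat.{0} (Hecke n v))
    [Module.Projective (Hecke n v) P] [Module.Finite (Hecke n v) P] :
    IsAdditiveFunction fun M => pairing P (res h M) := fun _ _ _ f g hf hg hfg _ =>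
  isAdditiveFunction_pairing P _ _ _ (resMap h f) (resMap h g) hf hg hfg inferInstance

/-- Induction is exact because in the model it is `M ↦ M^{n+1}`, where exactness is checked
coordinatewise. -/
theorem isAdditiveFunction_pairing_indModel (h : 1 + n = N) (P : ModuleCat.{0} (Hecke N v))
    [Module.Projective (Hecke N v) P] [Module.Finite (Hecke N v) P] :
    IsAdditiveFunction fun M => pairing P (indModel h M) := fun X Y Z f g hf hg hfg _ => by
  refine isAdditiveFunction_pairing P _ _ _ (indMap h f) (indMap h g) hf.comp_left hg.comp_left
    (fun y => ?_) inferInstance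
  obtain ⟨y, rfl⟩ := (toInd h Y).surjective y
  constructor
  · intro hy
    choose x hx using fun k => (hfg (y k)).1 (congrFun hy k)
    exact ⟨toInd h X x, congrArg (toInd h Y) (funext hx)⟩
  · rintro ⟨x, hx⟩
    obtain ⟨x, rfl⟩ := (toInd h X).surjective x
    rw [← hx]
    exact congrArg (toInd h Z) (funext fun k => hfg.apply_apply_eq_zero (x k))

/-- The component of the restriction of an induced module at the trivial coset. -/
def resIndFst (h : 1 + n = N) (M : ModuleCat.{0} (Hecke n v)) :
    res h (indModel h M) →ₗ[Hecke n v] M :=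
  homOfGen (LinearMap.proj 0 ∘ₗ (toInd h M).symm.toLinearMap ∘ₗ (toRes h _).symm.toLinearMap)
    fun i hi x => by
      obtain ⟨x, rfl⟩ := (toRes h _).surjective x
      obtain ⟨x, rfl⟩ := (toInd h M).surjective x
      rw [smul_toRes, shift_gen 1 h.le hi, gen_smul_toInd h M (by omega)]
      simp only [LinearMap.comp_apply, LinearEquiv.coe_coe, LinearEquiv.symm_apply_apply,
        LinearMap.proj_apply]
      -- Coordinate `0` lies below `1 + i`, so `T_{1+i}` acts there as `T_i` of `H_n`.
      rw [← Fin.mk_zero, indOp_of_lt _ _ (by omega), Nat.add_sub_cancel_left]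

/-- The components of the restriction of an induced module at the nontrivial cosets form the
module induced from the restriction. -/
def resIndSnd {p : ℕ} (h' : 1 + p = n) (h : 1 + n = N) (M : ModuleCat.{0} (Hecke n v)) :
    res h (indModel h M) →ₗ[Hecke n v] indModel h' (res h' M) :=
  homOfGen ((toInd h' _).toLinearMap ∘ₗ (toRes h' M).toLinearMap.compLeft _ ∘ₗ
      LinearMap.funLeft ℂ M (fun k : Fin (p + 1) => (⟨k + 1, by omega⟩ : Fin (n + 1))) ∘ₗ
      (toInd h M).symm.toLinearMap ∘ₗ (toRes h _).symm.toLinearMap)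
    fun i hi x => by
      obtain ⟨x, rfl⟩ := (toRes h _).surjective x
      obtain ⟨x, rfl⟩ := (toInd h M).surjective x
      rw [smul_toRes, shift_gen 1 h.le hi, gen_smul_toInd h M (by omega)]
      simp only [LinearMap.comp_apply, LinearEquiv.coe_coe, LinearEquiv.symm_apply_apply]
      rw [gen_smul_toInd h' _ (by omega)]
      congr 1
      ext ⟨k, hk⟩
      obtain rfl : n = p + 1 := by omega
      simp only [add_comm 1 i, LinearMap.compLeft_apply, Function.comp_apply,
        LinearMap.funLeft_apply, LinearEquiv.coe_coe]
      -- Dropping coordinate `0` lowers the generator index and the coset index together, so the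
      -- four cases of `indOp` match; the remaining shift of generators acting on `M` is the one
      -- built into `res`.
      rcases lt_trichotomy k i with hki | rfl | hki
      · obtain ⟨i, rfl⟩ := Nat.exists_eq_succ_of_ne_zero (show i ≠ 0 by omega)
        rw [indOp_of_lt _ _ (by omega), indOp_of_lt _ _ (by omega)]
        simp only [Nat.succ_eq_add_one, Nat.add_sub_cancel]
        change _ = gen p v i • toRes h' M (x ⟨k + 1, _⟩)
        rw [smul_toRes, shift_gen 1 h'.le (by omega), add_comm 1]
      · simp [indOp_self]
      · rcases Nat.lt_or_eq_of_le (Nat.succ_le_of_lt hki) with hki | rfl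
        · rw [indOp_of_gt _ _ (by omega), indOp_of_gt _ _ (by omega)]
          change _ = gen p v i • toRes h' M (x ⟨k + 1, _⟩)
          rw [smul_toRes, shift_gen 1 h'.le (by omega), add_comm 1]
        · simp [indOp_succ]

end Functors

/-! ### Frobenius reciprocity and the Mackey formula -/

section Frobenius

variable {n N : ℕ} {v : ℂ}

theorem pairing_congr_right (P : ModuleCat.{0} (Hecke n v)) {M M' : ModuleCat.{0} (Hecke n v)}
    (e : M ≃ₗ[Hecke n v] M') : pairing P M = pairing P M' :=
  LinearEquiv.finrank_eq (LinearEquiv.ofLinearMap (postcompLinear P e.toLinearMap)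
    (postcompLinear P e.symm.toLinearMap) (by ext; simp [postcompLinear])
    (by ext; simp [postcompLinear]))

/-- The quotient map onto an induced module. -/
def indMk {m : ℕ} (h : m + n = N) (X : ModuleCat.{0} (Hecke m v)) (Y : ModuleCat.{0} (Hecke n v)) :
    Hecke N v ⊗[ℂ] (X ⊗[ℂ] Y) →ₗ[Hecke N v] indProd h X Y :=
  (indRel h X Y).mkQ

theorem indMk_surjective {m : ℕ} (h : m + n = N) (X : ModuleCat.{0} (Hecke m v))
    (Y : ModuleCat.{0} (Hecke n v)) : Function.Surjective (indMk h X Y) :=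
  (indRel h X Y).mkQ_surjective

theorem indMk_rel {m : ℕ} (h : m + n = N) (X : ModuleCat.{0} (Hecke m v))
    (Y : ModuleCat.{0} (Hecke n v)) (a : Hecke N v) (b : Hecke m v) (c : Hecke n v) (x : X)
    (y : Y) : indMk h X Y ((a * extMul v h (b ⊗ₜ c)) ⊗ₜ (x ⊗ₜ y)) =
      indMk h X Y (a ⊗ₜ ((b • x) ⊗ₜ (c • y))) :=
  (Submodule.Quotient.eq _).2 (Submodule.subset_span ⟨a, b, c, x, y, rfl⟩)

variable (h : 1 + n = N) {X : ModuleCat.{0} (Hecke 1 v)} (Y : ModuleCat.{0} (Hecke n v))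
  {Z : ModuleCat.{0} (Hecke N v)}

/-- The generating copy of `Y` in the product of a one-dimensional module and `Y`. -/
def toIndProd (x₀ : X) : Y →ₗ[Hecke n v] res h (indProd h X Y) where
  toFun y := toRes h _ (indMk h X Y (1 ⊗ₜ (x₀ ⊗ₜ y)))
  map_add' y y' := by simp only [TensorProduct.tmul_add, map_add]
  map_smul' c y := by
    rw [RingHom.id_apply, smul_toRes]
    congr 1
    have := indMk_rel h X Y 1 1 c x₀ y
    rw [one_smul, extMul, Algebra.TensorProduct.lift_tmul, map_one, one_mul, one_mul] at this
    rw [← this, ← map_smul, TensorProduct.smul_tmul', smul_eq_mul, mul_one]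

variable {Y}

/-- The homomorphism from the product of a one-dimensional module and `Y` determined by a
homomorphism from `Y` to a restriction. -/
def indProdLift (φ : X →ₗ[ℂ] ℂ) (f : Y →ₗ[Hecke n v] res h Z) :
    indProd h X Y →ₗ[Hecke N v] Z :=
  (indRel h X Y).liftQ (TensorProduct.AlgebraTensorModule.lift
    (LinearMap.toSpanSingleton (Hecke N v) (X ⊗[ℂ] Y →ₗ[ℂ] Z)
      (TensorProduct.lift (φ.smulRight
        ((toRes h Z).symm.toLinearMap ∘ₗ LinearMap.restrictScalars ℂ f))))) <| by
    refine Submodule.span_le.2 ?_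
    rintro _ ⟨a, b, c, x, y, rfl⟩
    -- `H_1` consists of scalars, so only the relations coming from `H_n` have content.
    obtain ⟨b, rfl⟩ := algebraMap_surjective_of_le_one le_rfl b
    obtain ⟨z, hz⟩ := (toRes h Z).surjective (f y)
    simp [extMul, mul_smul, ← hz, smul_toRes, sub_eq_zero]
    rw [smul_comm (φ x)]

theorem indProdLift_mk (φ : X →ₗ[ℂ] ℂ) (f : Y →ₗ[Hecke n v] res h Z) (a : Hecke N v) (x : X)
    (y : Y) : indProdLift h φ f (indMk h X Y (a ⊗ₜ (x ⊗ₜ y))) =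
      a • φ x • (toRes h Z).symm (f y) := rfl

theorem exists_generator_of_finrank_eq_one {V : Type*} [AddCommGroup V] [Module ℂ V]
    (hV : Module.finrank ℂ V = 1) :
    ∃ (x₀ : V) (φ : V →ₗ[ℂ] ℂ), φ x₀ = 1 ∧ ∀ x, φ x • x₀ = x := by
  have : Module.Finite ℂ V := Module.finite_of_finrank_eq_succ hV
  let e : V ≃ₗ[ℂ] ℂ := LinearEquiv.ofFinrankEq V ℂ (by simp [hV])
  exact ⟨e.symm 1, e.toLinearMap, by simp, fun x => e.injective (by simp)⟩

theorem indProd_induction {x₀ : X} (hx : ∀ x : X, ∃ c : ℂ, c • x₀ = x)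
    {p : indProd h X Y → Prop} (hadd : ∀ x y, p x → p y → p (x + y)) (hzero : p 0)
    (hmk : ∀ (a : Hecke N v) y, p (a • (toRes h _).symm (toIndProd h Y x₀ y))) (z : indProd h X Y) : p z := by
  obtain ⟨z, rfl⟩ := indMk_surjective h X Y z
  induction z with
  | zero => simpa using hzero
  | add x y hx hy => simpa using hadd _ _ hx hy
  | tmul a w =>
    induction w with
    | zero => simpa using hzero
    | add x y hx hy => simpa [TensorProduct.tmul_add] using hadd _ _ hx hy
    | tmul x y =>
      obtain ⟨c, rfl⟩ := hx x
      convert hmk a (c • y) using 1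
      change _ = a • indMk h X Y (1 ⊗ₜ (x₀ ⊗ₜ (c • y)))
      rw [← map_smul, TensorProduct.smul_tmul', smul_eq_mul, mul_one, TensorProduct.smul_tmul]

/-- Frobenius reciprocity for the product with a one-dimensional module. -/
theorem pairing_indProd (hX : Module.finrank ℂ X = 1) (Y : ModuleCat.{0} (Hecke n v))
    (Z : ModuleCat.{0} (Hecke N v)) : pairing (indProd h X Y) Z = pairing Y (res h Z) := by
  obtain ⟨x₀, φ, hφ, hx⟩ := exists_generator_of_finrank_eq_one hX
  exact LinearEquiv.finrank_eq
    { toFun := fun F => resMap h F ∘ₗ toIndProd h Y x₀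
      invFun := fun f => indProdLift h φ f
      map_add' := fun F G => by
        ext y
        rfl
      map_smul' := fun c F => by
        ext y
        exact (toRes h Z).map_smul c _
      left_inv := fun F => by
        ext z
        refine indProd_induction h (fun x => ⟨φ x, hx x⟩)
          (p := fun z => indProdLift h φ (resMap h F ∘ₗ toIndProd h Y x₀) z = F z)
          (fun x y hx hy => by rw [map_add, map_add, hx, hy]) (by simp) (fun a y => ?_) z
        rw [map_smul, map_smul]
        congr 1
        refine (indProdLift_mk h φ _ 1 x₀ y).trans ?_
        rw [hφ, one_smul, one_smul]
        rfl
      right_inv := fun f => by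
        ext y
        refine congrArg (toRes h Z) (indProdLift_mk h φ f 1 x₀ y) |>.trans ?_
        rw [hφ, one_smul, one_smul, LinearEquiv.apply_symm_apply] }

/-- `T_k` moves a vector supported at `k` to `k + 1` with no other term, so the coordinates of the
model are coefficients at the representatives. -/
theorem cosetRep_smul_single (Y : ModuleCat.{0} (Hecke n v)) {k : ℕ} (hk : k < n + 1) (y : Y) :
    cosetRep N v k • toInd h Y (Pi.single 0 y) = toInd h Y (Pi.single ⟨k, hk⟩ y) := by
  induction k with
  | zero => simp [cosetRep]
  | succ k ih =>
    rw [cosetRep, mul_smul, ih (by omega), gen_smul_toInd h Y (by omega)]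
    congr 1
    ext ⟨j, hj⟩
    have hs : ∀ {a b : ℕ} (ha : a < n + 1) (hb : b < n + 1),
      (Pi.single (⟨a, ha⟩ : Fin (n + 1)) y : Fin (n + 1) → Y) ⟨b, hb⟩ = if b = a then y else 0 :=
      fun ha hb => by simp [Pi.single_apply]
    rcases lt_trichotomy j k with hjk | rfl | hjk
    · rw [indOp_of_lt _ _ hjk, hs, hs, if_neg (by omega), if_neg (by omega), smul_zero]
    · rw [indOp_self, hs, hs, if_neg (by omega), if_neg (by omega), smul_zero]
    · rcases Nat.lt_or_eq_of_le (Nat.succ_le_of_lt hjk) with hjk | rfl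
      · rw [indOp_of_gt _ _ hjk, hs, hs, if_neg (by omega), if_neg (by omega), smul_zero]
      · refine (indOp_succ _ hk _).trans ?_
        rw [hs, hs, hs, if_pos rfl, if_neg (by omega), if_pos rfl, smul_zero, add_zero]

/-- The inclusion of a module as the component at the trivial coset. -/
def toResInd (Y : ModuleCat.{0} (Hecke n v)) : Y →ₗ[Hecke n v] res h (indModel h Y) :=
  homOfGen ((toRes h _).toLinearMap ∘ₗ (toInd h Y).toLinearMap ∘ₗ LinearMap.single ℂ (fun _ : Fin (n + 1) => Y) 0)
    fun i hi y => by
      simp only [LinearMap.comp_apply, LinearEquiv.coe_coe]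
      rw [smul_toRes, shift_gen 1 h.le hi, gen_smul_toInd h Y (by omega)]
      congr 2
      ext ⟨j, hj⟩
      simp only [LinearMap.single_apply, indOp, LinearMap.coe_mk, AddHom.coe_mk]
      by_cases hj0 : j = 0
      · subst hj0
        simp
      · simp [hj0]

theorem toResInd_apply (Y : ModuleCat.{0} (Hecke n v)) (y : Y) :
    toResInd h Y y = toRes h _ (toInd h Y (Pi.single 0 y)) := rfl

/-- The product of a one-dimensional module and `Y` is isomorphic to the model. -/
theorem nonempty_indProd_equiv (hX : Module.finrank ℂ X = 1) (Y : ModuleCat.{0} (Hecke n v)) :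
    Nonempty (indProd h X Y ≃ₗ[Hecke N v] indModel h Y) := by
  obtain ⟨x₀, φ, hφ, hx⟩ := exists_generator_of_finrank_eq_one hX
  let F : indProd h X Y →ₗ[Hecke N v] indModel h Y := indProdLift h φ (toResInd h Y)
  let q : Y →ₗ[ℂ] indProd h X Y :=
    (toRes h _).symm.toLinearMap ∘ₗ LinearMap.restrictScalars ℂ (toIndProd h Y x₀)
  have hF : ∀ y, F (q y) = toInd h Y (Pi.single 0 y) := fun y => by
    refine (indProdLift_mk h φ (toResInd h Y) 1 x₀ y).trans ?_
    rw [hφ, one_smul, one_smul, toResInd_apply, LinearEquiv.symm_apply_apply]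
  -- `B` is surjective by straightening, and `F ∘ B` is the identity on coordinates. Hence `F` is
  -- bijective, which is the independence of the representatives.
  let B : (Fin (n + 1) → Y) → indProd h X Y := fun y => ∑ k : Fin (n + 1), cosetRep N v k • q (y k)
  have hFB : ∀ y, F (B y) = toInd h Y y := fun y => by
    simp only [B, map_sum, map_smul, hF, cosetRep_smul_single h Y (Fin.is_lt _)]
    rw [← map_sum]
    exact congrArg _ (Finset.univ_sum_single y)
  have hadd : ∀ y z, B (y + z) = B y + B z := fun y z => by
    simp [B, smul_add, Finset.sum_add_distrib]
  have hB : Function.Surjective B := fun z => by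
    refine indProd_induction h (fun x => ⟨φ x, hx x⟩) (p := fun z => ∃ y, B y = z) ?_ ⟨0, by simp [B]⟩ (fun a y => ?_) z
    · rintro _ _ ⟨y, rfl⟩ ⟨z, rfl⟩
      exact ⟨y + z, hadd y z⟩
    · refine exists_sum_cosetRep h q (fun c x => ?_) a y
      simp only [q, LinearMap.comp_apply, LinearMap.coe_restrictScalars, map_smul]
      rfl
  refine ⟨LinearEquiv.ofBijective F ⟨fun x y hxy => ?_, fun z => ?_⟩⟩
  · obtain ⟨x, rfl⟩ := hB x
    obtain ⟨y, rfl⟩ := hB y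
    rw [hFB, hFB] at hxy
    rw [(toInd h Y).injective hxy]
  · obtain ⟨z, rfl⟩ := (toInd h Y).surjective z
    exact ⟨B z, hFB z⟩

/-- The Mackey formula. -/
theorem pairing_res_indModel {p : ℕ} (h' : 1 + p = n) (P M : ModuleCat.{0} (Hecke n v))
    [Module.Projective (Hecke n v) P] [Module.Finite (Hecke n v) P]
    [Module.Finite (Hecke n v) M] :
    pairing P (res h (indModel h M)) = pairing P M + pairing P (indModel h' (res h' M)) := by
  let f := (resIndFst h M).prod (resIndSnd h' h M)
  have hf : Function.Bijective f := by
    have hfx : ∀ x : Fin (n + 1) → M, f (toRes h _ (toInd h M x)) =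
        (x 0, toInd h' _ fun k => toRes h' M (x ⟨k + 1, by omega⟩)) := fun x => rfl
    constructor
    · intro x y hxy
      obtain ⟨x, rfl⟩ := ((toInd h M).trans (toRes h _)).surjective x
      obtain ⟨y, rfl⟩ := ((toInd h M).trans (toRes h _)).surjective y
      simp only [LinearEquiv.trans_apply, hfx, Prod.mk.injEq] at hxy
      congr 1
      ext ⟨k, hk⟩
      cases k with
      | zero => exact hxy.1
      | succ k =>
        exact (toRes h' M).injective (congrFun ((toInd h' _).injective hxy.2) ⟨k, by omega⟩)
    · rintro ⟨a, b⟩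
      obtain ⟨b, rfl⟩ := (toInd h' _).surjective b
      refine ⟨toRes h _ (toInd h M fun k =>
        if hk : (k : ℕ) = 0 then a else (toRes h' M).symm (b ⟨k - 1, by omega⟩)), ?_⟩
      rw [hfx]
      simp
  let e := LinearEquiv.ofBijective f hf
  -- Only dimensions matter, so the direct sum enters as a short exact sequence.
  refine isAdditiveFunction_pairing P M (res h (indModel h M)) (indModel h' (res h' M))
    (e.symm.toLinearMap ∘ₗ LinearMap.inl (Hecke n v) M (indModel h' (res h' M)))
    (LinearMap.snd (Hecke n v) M (indModel h' (res h' M)) ∘ₗ e.toLinearMap)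
    (e.symm.injective.comp fun a b hab => (Prod.ext_iff.1 hab).1)
    (Prod.snd_surjective.comp e.surjective) (fun x => ?_) inferInstance
  obtain ⟨⟨a, b⟩, rfl⟩ := e.symm.surjective x
  constructor
  · intro hb
    obtain rfl : b = 0 := by simpa using hb
    exact ⟨a, rfl⟩
  · rintro ⟨a', ha⟩
    have := e.symm.injective ha
    simp_all

/-- At `n = 0` the trivial coset is the only one, so the `Ind Res` term is absent. -/
theorem pairing_res_indModel_zero (h : 1 + 0 = N) (P M : ModuleCat.{0} (Hecke 0 v)) :
    pairing P (res h (indModel h M)) = pairing P M := by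
  refine pairing_congr_right P (LinearEquiv.ofBijective (resIndFst h M) ⟨fun x y hxy => ?_,
    fun y => ⟨toResInd h M y, ?_⟩⟩)
  · obtain ⟨x, rfl⟩ := ((toInd h M).trans (toRes h _)).surjective x
    obtain ⟨y, rfl⟩ := ((toInd h M).trans (toRes h _)).surjective y
    congr 1
    ext k
    obtain rfl : k = 0 := Fin.fin_one_eq_zero k
    exact hxy
  · change (Pi.single 0 y : Fin 1 → M) 0 = y
    simp

end Frobenius
end Hecke

/-! ### Dual graded graphs -/

namespace WeightedGraph

variable {V : Type*} {Γ Γ' : WeightedGraph V}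

theorem up_single (Γ : WeightedGraph V) {v : V} {s : Finset V} (hs : ∀ u, Γ.mult v u ≠ 0 → u ∈ s) :
    Γ.up (Finsupp.single v 1) = ∑ u ∈ s, Finsupp.single u (Γ.mult v u : ℤ) := by
  rw [up, Finsupp.linearCombination_single, one_smul]
  refine finsum_eq_sum_of_support_subset _ fun u hu => hs u fun h0 => hu ?_
  simp [h0]

theorem down_single (Γ : WeightedGraph V) {v : V} {s : Finset V}
    (hs : ∀ u, Γ.mult u v ≠ 0 → u ∈ s) :
    Γ.down (Finsupp.single v 1) = ∑ u ∈ s, Finsupp.single u (Γ.mult u v : ℤ) := by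
  rw [down, Finsupp.linearCombination_single, one_smul]
  refine finsum_eq_sum_of_support_subset _ fun u hu => hs u fun h0 => hu ?_
  simp [h0]

theorem up_single_apply (hΓ : Γ.IsGraded) (v w : V) :
    Γ.up (Finsupp.single v 1) w = Γ.mult v w := by
  classical
  rw [up_single Γ (s := (hΓ.finite_out v).toFinset) (by simp), Finsupp.finsetSum_apply]
  simp [Finsupp.single_apply, eq_comm]

theorem down_single_apply (hΓ : Γ.IsGraded) (v w : V) :
    Γ.down (Finsupp.single v 1) w = Γ.mult w v := by
  classical
  rw [down_single Γ (s := (hΓ.finite_in v).toFinset) (by simp), Finsupp.finsetSum_apply]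
  simp [Finsupp.single_apply, eq_comm]

/-- The commutation relation in terms of edge multiplicities. -/
theorem commutator_eq_id [DecidableEq V] (hΓ : Γ.IsGraded) (hΓ' : Γ'.IsGraded)
    (out inn : V → Finset V) (hout : ∀ v u, Γ.mult v u ≠ 0 → u ∈ out v)
    (hinn : ∀ v u, Γ'.mult u v ≠ 0 → u ∈ inn v)
    (h : ∀ v w, ∑ u ∈ out v, Γ.mult v u * Γ'.mult w u =
      (if v = w then 1 else 0) + ∑ u ∈ inn v, Γ'.mult u v * Γ.mult u w) :
    Γ'.down ∘ₗ Γ.up - Γ.up ∘ₗ Γ'.down = (1 : ℤ) • LinearMap.id := by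
  have hsingle : ∀ (u : V) (c : ℤ), Finsupp.single u c = c • Finsupp.single u 1 := fun u c => by
    simp
  ext v w
  simp only [LinearMap.comp_apply, LinearMap.sub_apply, Finsupp.lsingle_apply,
    up_single Γ (hout v), down_single Γ' (hinn v), map_sum, Finsupp.sub_apply,
    Finsupp.finsetSum_apply, one_smul, LinearMap.id_apply]
  have hU : ∀ u : V, Γ'.down (Finsupp.single u (Γ.mult v u : ℤ)) w =
      (Γ.mult v u * Γ'.mult w u : ℕ) := fun u => by
    rw [hsingle, map_smul, Finsupp.smul_apply, down_single_apply hΓ']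
    simp
  have hD : ∀ u : V, Γ.up (Finsupp.single u (Γ'.mult u v : ℤ)) w =
      (Γ'.mult u v * Γ.mult u w : ℕ) := fun u => by
    rw [hsingle, map_smul, Finsupp.smul_apply, up_single_apply hΓ]
    simp
  simp only [hU, hD]
  rw [← Nat.cast_sum, ← Nat.cast_sum, h v w, Finsupp.single_apply]
  push_cast
  ring

end WeightedGraph

namespace Hecke

/-! ### The algebras `H_0(v)` and `H_1(v)` -/

section Small

variable {n : ℕ} {v : ℂ}

theorem nontrivial_of_le_one (hn : n ≤ 1) : Nontrivial (Hecke n v) := by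
  have : IsEmpty (Fin (n - 1)) := ⟨fun i => by have := i.isLt; omega⟩
  exact (lift (n := n) (v := v) (FreeAlgebra.lift ℂ fun _ => (0 : ℂ)) (by
    rintro _ _ (i | ⟨i, _, _⟩ | ⟨i, _, _⟩) <;> exact isEmptyElim i)).toRingHom.domain_nontrivial

theorem isSimpleModule_self_of_le_one (hn : n ≤ 1) : IsSimpleModule (Hecke n v) (Hecke n v) := by
  refine isSimpleModule_self_iff_isUnit.2 ⟨nontrivial_of_le_one hn, fun x hx => ?_⟩
  obtain ⟨c, rfl⟩ := algebraMap_surjective_of_le_one hn x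
  exact (IsUnit.mk0 c fun h => hx (by simp [h])).map _

theorem finrank_self_of_le_one (hn : n ≤ 1) : Module.finrank ℂ (Hecke n v) = 1 := by
  have := nontrivial_of_le_one (v := v) hn
  refine finrank_eq_one (1 : Hecke n v) one_ne_zero fun x => ?_
  obtain ⟨c, rfl⟩ := algebraMap_surjective_of_le_one hn x
  exact ⟨c, (Algebra.algebraMap_eq_smul_one c).symm⟩

theorem nonempty_equiv_self (hn : n ≤ 1) (S : Type*) [AddCommGroup S] [Module (Hecke n v) S]
    [IsSimpleModule (Hecke n v) S] : Nonempty (Hecke n v ≃ₗ[Hecke n v] S) := by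
  have := isSimpleModule_self_of_le_one (v := v) hn
  have := IsSimpleModule.nontrivial (Hecke n v) S
  obtain ⟨x, hx⟩ := exists_ne (0 : S)
  exact ⟨LinearEquiv.ofBijective (LinearMap.toSpanSingleton (Hecke n v) S x)
    (LinearMap.bijective_of_ne_zero fun h0 => hx (by simpa using LinearMap.congr_fun h0 1))⟩

variable (L : SimpleProjectiveList (Hecke n v))

theorem card_eq_one (hn : n ≤ 1) : L.card = 1 := by
  have := isSimpleModule_self_of_le_one (v := v) hn
  obtain ⟨i, -⟩ := L.simple_complete (Hecke n v) this
  have : Subsingleton (Fin L.card) := ⟨fun i j => by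
    have := L.simple i
    have := L.simple j
    obtain ⟨e⟩ := nonempty_equiv_self (v := v) hn (L.S i)
    obtain ⟨f⟩ := nonempty_equiv_self (v := v) hn (L.S j)
    exact L.simple_inj i j ⟨e.symm.trans f⟩⟩
  have := Fin.subsingleton_iff_le_one.1 this
  have := i.isLt
  omega

theorem finrank_S (hn : n ≤ 1) (i : Fin L.card) : Module.finrank ℂ (L.S i) = 1 := by
  have := L.simple i
  obtain ⟨e⟩ := nonempty_equiv_self (v := v) hn (L.S i)
  rw [← (e.restrictScalars ℂ).finrank_eq, finrank_self_of_le_one hn]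

theorem finrank_P (hn : n ≤ 1) (i : Fin L.card) : Module.finrank ℂ (L.P i) = 1 := by
  have := isSimpleModule_self_of_le_one (v := v) hn
  obtain ⟨j, ⟨e⟩⟩ := L.projective_complete (Hecke n v) inferInstance inferInstance
    ⟨IsSimpleModule.nontrivial (Hecke n v) _, fun A B hAB => (eq_bot_or_eq_top A).imp_right
      fun hA => by simpa [hA] using hAB.inf_eq_bot⟩
  have : Subsingleton (Fin L.card) := Fin.subsingleton_iff_le_one.2 (card_eq_one L hn).le
  rw [Subsingleton.elim i j, ← (e.restrictScalars ℂ).finrank_eq, finrank_self_of_le_one hn]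

end Small

/-! ### The branching graphs -/

section Branching

variable {n N : ℕ} {v : ℂ}

instance finite_S (L : SimpleProjectiveList (Hecke n v)) (i : Fin L.card) :
    Module.Finite (Hecke n v) (L.S i) :=
  have := L.simple i
  inferInstance

theorem pairing_P_S (L : SimpleProjectiveList (Hecke n v)) (i j : Fin L.card) :
    pairing (L.P i) (L.S j) = if i = j then 1 else 0 :=
  L.finrank_hom i j

/-- The value of an additive function is determined by composition multiplicities. -/
theorem eq_sum_pairing (L : SimpleProjectiveList (Hecke n v))
    {F : ModuleCat.{0} (Hecke n v) → ℕ} (hF : IsAdditiveFunction F)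
    (M : ModuleCat.{0} (Hecke n v)) [Module.Finite (Hecke n v) M] :
    ∑ j, pairing (L.P j) M * F (L.S j) = F M := by
  have hP := L.projective
  have hPf := L.finite
  have hG : IsAdditiveFunction fun X => ∑ j, pairing (L.P j) X * F (L.S j) :=
    IsAdditiveFunction.sum_mul _ (fun j => pairing (L.P j)) _
      fun j => isAdditiveFunction_pairing (L.P j)
  refine hG.eq_of_simple hF (fun S hS => ?_)
    (isFiniteLength_iff_isNoetherian_isArtinian.2 ⟨inferInstance, inferInstance⟩)
  obtain ⟨k, ⟨e⟩⟩ := L.simple_complete S hS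
  rw [hG.congr e, hF.congr e]
  simp [pairing_P_S]

variable (L : ∀ n, SimpleProjectiveList (Hecke n v))

/-- `H_1` has a single simple module and a one-dimensional cover, so the sum collapses to a
composition multiplicity of the induced module. -/
theorem simpleGraph_mult (h : 1 + n = N) (i : Fin (L n).card) (j : Fin (L N).card) :
    (simpleGraph L).mult ⟨n, i⟩ ⟨N, j⟩ = pairing ((L N).P j) (indModel h ((L n).S i)) := by
  have key : ∀ l, Module.finrank ℂ ((L 1).P l) *
      pairing ((L N).P j) (indProd h ((L 1).S l) ((L n).S i)) =
        pairing ((L N).P j) (indModel h ((L n).S i)) := fun l => by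
    obtain ⟨e⟩ := nonempty_indProd_equiv h (finrank_S (L 1) le_rfl l) ((L n).S i)
    rw [finrank_P _ le_rfl, one_mul, pairing_congr_right _ e]
  simp [simpleGraph, h, key, card_eq_one (L 1) le_rfl]

/-- Frobenius reciprocity moves induction off the projective, so that both graphs are computed by
functors applied to simple modules. -/
theorem projectiveGraph_mult (h : 1 + n = N) (i : Fin (L n).card) (j : Fin (L N).card) :
    (projectiveGraph L).mult ⟨n, i⟩ ⟨N, j⟩ = pairing ((L n).P i) (res h ((L N).S j)) := by
  have key : ∀ l, Module.finrank ℂ ((L 1).S l) *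
      pairing (indProd h ((L 1).P l) ((L n).P i)) ((L N).S j) =
        pairing ((L n).P i) (res h ((L N).S j)) := fun l => by
    rw [finrank_S _ le_rfl, one_mul, pairing_indProd h (finrank_P (L 1) le_rfl l)]
  simp [projectiveGraph, h, key, card_eq_one (L 1) le_rfl]

theorem simpleGraph_height {x y : Vertex L} (h : (simpleGraph L).mult x y ≠ 0) :
    1 + x.1 = y.1 := by
  by_contra h0
  exact h (dif_neg h0)

theorem projectiveGraph_height {x y : Vertex L} (h : (projectiveGraph L).mult x y ≠ 0) :
    1 + x.1 = y.1 := by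
  by_contra h0
  exact h (dif_neg h0)

/-- The vertices of a given height. -/
def level (n : ℕ) : Finset (Vertex L) := Finset.univ.map (.sigmaMk n)

theorem mem_level {x : Vertex L} : x ∈ level L n ↔ x.1 = n := by
  obtain ⟨m, i⟩ := x
  simp only [level, Finset.mem_map, Finset.mem_univ, true_and, Function.Embedding.sigmaMk_apply]
  constructor
  · rintro ⟨j, hj⟩
    exact (congrArg Sigma.fst hj).symm
  · rintro rfl
    exact ⟨i, rfl⟩

theorem isGraded_of_height (Γ : WeightedGraph (Vertex L)) (hh : Γ.height = Sigma.fst)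
    (hm : ∀ x y, Γ.mult x y ≠ 0 → 1 + x.1 = y.1) : Γ.IsGraded where
  height_eq x y h := by
    rw [hh, ← hm x y h, add_comm]
  existsUnique_root := by
    rw [hh]
    have h1 := card_eq_one (L 0) zero_le_one
    refine ⟨⟨0, ⟨0, by omega⟩⟩, rfl, ?_⟩
    rintro ⟨m, i⟩ hm
    obtain rfl : m = 0 := hm
    have : Subsingleton (Fin (L 0).card) := Fin.subsingleton_iff_le_one.2 h1.le
    exact congrArg _ (Subsingleton.elim _ _)
  finite_out x := (level L (1 + x.1)).finite_toSet.subset fun y hy =>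
    (mem_level L).2 (hm x y hy).symm
  finite_in x := (level L (x.1 - 1)).finite_toSet.subset fun y hy =>
    (mem_level L).2 (by have := hm y x hy; omega)

/-- This is the Mackey formula in multiplicities. The separate case at height `0` is needed because
truncated `0 - 1` would name level `0` as the level below. -/
theorem sum_mult_mul_mult (x y : Vertex L) :
    ∑ u ∈ level L (1 + x.1), (simpleGraph L).mult x u * (projectiveGraph L).mult y u =
      (if x = y then 1 else 0) + ∑ u ∈ (if x.1 = 0 then ∅ else level L (x.1 - 1)),
        (projectiveGraph L).mult u x * (simpleGraph L).mult u y := by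
  obtain ⟨n, i⟩ := x
  obtain ⟨k, l⟩ := y
  by_cases hk : n = k
  swap
  · rw [if_neg (fun h => hk (congrArg Sigma.fst h)), zero_add, Finset.sum_eq_zero,
      Finset.sum_eq_zero]
    · intro u _
      by_contra h0
      have h1 := projectiveGraph_height L (left_ne_zero_of_mul h0)
      have h2 := simpleGraph_height L (right_ne_zero_of_mul h0)
      exact hk (h1.symm.trans h2)
    · intro u hu
      by_contra h0
      have h1 := simpleGraph_height L (left_ne_zero_of_mul h0)
      have h2 := projectiveGraph_height L (right_ne_zero_of_mul h0)
      exact hk (by simpa using h1.trans h2.symm)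
  subst hk
  have hP := (L n).projective l
  have hPf := (L n).finite l
  have hif : (if (⟨n, i⟩ : Vertex L) = ⟨n, l⟩ then 1 else 0) =
      pairing ((L n).P l) ((L n).S i) := by
    simp [pairing_P_S, eq_comm]
  rw [hif]
  simp only [level, Finset.sum_map, Function.Embedding.sigmaMk_apply, simpleGraph_mult L rfl,
    projectiveGraph_mult L rfl]
  -- The composition factors of `Ind S_i` are summed against `dim Hom(P_l, Res -)`, giving `dim
  -- Hom(P_l, Res Ind S_i)`.
  rw [eq_sum_pairing (L (1 + n)) (isAdditiveFunction_pairing_res rfl ((L n).P l))]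
  rcases n with _ | p
  · simp [pairing_res_indModel_zero]
  · have h' : 1 + p = p + 1 := add_comm _ _
    rw [pairing_res_indModel rfl h']
    rw [if_neg (Nat.succ_ne_zero p)]
    change _ = _ + ∑ u ∈ Finset.univ.map (.sigmaMk p), _
    simp only [Finset.sum_map, Function.Embedding.sigmaMk_apply, simpleGraph_mult L h',
      projectiveGraph_mult L h']
    -- Likewise the factors of `Res S_i` against `dim Hom(P_l, Ind -)` give the `Ind Res` term.
    rw [eq_sum_pairing (L p) (isAdditiveFunction_pairing_indModel h' ((L (p + 1)).P l))]

end Branching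

end Hecke

end

theorem corollaryC (r : ℕ) (hr : 0 < r) (ζ : ℂ) (hζ : IsPrimitiveRoot ζ r) :
    (∀ n : ℕ, Nonempty (SimpleProjectiveList (Hecke n ζ))) ∧
      ∀ L : ∀ n : ℕ, SimpleProjectiveList (Hecke n ζ),
        WeightedGraph.IsDualPair (Hecke.simpleGraph L) (Hecke.projectiveGraph L) 1 := by
  refine ⟨fun n => SimpleProjectiveList.nonempty _, fun L => ?_⟩
  have hΓ := Hecke.isGraded_of_height L (Hecke.simpleGraph L) rfl
    fun _ _ => Hecke.simpleGraph_height L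
  have hΓ' := Hecke.isGraded_of_height L (Hecke.projectiveGraph L) rfl
    fun _ _ => Hecke.projectiveGraph_height L
  refine ⟨hΓ, hΓ', rfl, WeightedGraph.commutator_eq_id hΓ hΓ'
    (fun x => Hecke.level L (1 + x.1)) (fun x => if x.1 = 0 then ∅ else Hecke.level L (x.1 - 1))
    (fun x u h => (Hecke.mem_level L).2 (Hecke.simpleGraph_height L h).symm) (fun x u h => ?_)
    (Hecke.sum_mult_mul_mult L)⟩
  have := Hecke.projectiveGraph_height L h
  rw [if_neg (by omega), Hecke.mem_level]
  omega
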